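/- Let $a,b,c,d$ be positive integers with $a+b=c+d$. There exists a Borel set $E\subset[0,1]$ of Fourier dimension exactly $1/2$ that contains no nontrivial solution $(x_1,x_2,y_1,y_2)\in E^4$ of $$ax_1+bx_2=cy_1+dy_2.$$ Here the Fourier dimension of a Borel set $E\subset\mathbb R$ is the supremum of those $\beta\in[0,1]$ for which there are a probability measure $\mu$ supported on $E$ and a constant $C\in(0,\infty)$ with $|\hat\mu(\xi)|\le C(1+|\xi|)^{-\beta/2}$ for all $\xi\in\mathbb R$, where $\hat\mu(\xi)=\int e^{-2\pi i x\xi}\,d\mu(x)$. The equation has genus one if no nonempty proper subfamily of the coefficients $a,b,-c,-d$ (counted with multiplicity) sums to zero, and genus two otherwise; in the latter case $\{a,b\}=\{c,d\}$ as multisets. If the genus is one, a solution is trivial when $x_1=x_2=y_1=y_2$. If the genus is two, a solution is trivial when its two sides agree after matching equal coefficients, that is, when $a=c$, $b=d$, $x_1=y_1$, $x_2=y_2$, or $a=d$, $b=c$, $x_1=y_2$, $x_2=y_1$. All other solutions are nontrivial. -/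

import Mathlib

open scoped Real

/-- The coefficients `(a, b, -c, -d)` of the equation `a x₁ + b x₂ - c y₁ - d y₂ = 0`. -/
def eqCoeff (a b c d : ℕ) : Fin 4 → ℤ := ![(a : ℤ), (b : ℤ), -(c : ℤ), -(d : ℤ)]

/-- Genus one: no nonempty proper sub-family of the four coefficients (counted with
multiplicity) sums to zero. -/
def IsGenusOne (a b c d : ℕ) : Prop :=
  ∀ T : Finset (Fin 4), T.Nonempty → T ≠ Finset.univ → ∑ i ∈ T, eqCoeff a b c d i ≠ 0

/-- `(x₁, x₂, y₁, y₂)` solves `a x₁ + b x₂ = c y₁ + d y₂`. -/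
def IsSolution (a b c d : ℕ) (x₁ x₂ y₁ y₂ : ℝ) : Prop :=
  (a : ℝ) * x₁ + (b : ℝ) * x₂ = (c : ℝ) * y₁ + (d : ℝ) * y₂

/-- Trivial solutions. In genus one, all four entries coincide. In genus two, where
`{a, b} = {c, d}`, the two sides agree after matching equal coefficients: `x₁ = y₁, x₂ = y₂` when
`a = c, b = d`, and `x₁ = y₂, x₂ = y₁` when `a = d, b = c`
(both kinds are trivial when all coefficients are equal). -/
def IsTrivialSolution (a b c d : ℕ) (x₁ x₂ y₁ y₂ : ℝ) : Prop :=
  IsSolution a b c d x₁ x₂ y₁ y₂ ∧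
    ((IsGenusOne a b c d ∧ x₁ = x₂ ∧ x₂ = y₁ ∧ y₁ = y₂) ∨
      (¬ IsGenusOne a b c d ∧
        ((a = c ∧ b = d ∧ x₁ = y₁ ∧ x₂ = y₂) ∨ (a = d ∧ b = c ∧ x₁ = y₂ ∧ x₂ = y₁))))

/-- Nontrivial solutions: all the others. -/
def IsNontrivialSolution (a b c d : ℕ) (x₁ x₂ y₁ y₂ : ℝ) : Prop :=
  IsSolution a b c d x₁ x₂ y₁ y₂ ∧ ¬ IsTrivialSolution a b c d x₁ x₂ y₁ y₂

/-- The Fourier transform of a measure on the line. -/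
noncomputable def measureFourier (μ : MeasureTheory.Measure ℝ) (ξ : ℝ) : ℂ :=
  ∫ x : ℝ, Complex.exp (-(2 * π * x * ξ : ℝ) * Complex.I) ∂μ

/-- The exponents `β ∈ [0, 1]` for which some probability measure carried by `E` satisfies
`|μ̂(ξ)| ≤ C (1 + |ξ|) ^ (-β / 2)` for all real `ξ`. -/
def fourierDecayExponents (E : Set ℝ) : Set ℝ :=
  {β : ℝ | 0 ≤ β ∧ β ≤ 1 ∧
    ∃ μ : MeasureTheory.Measure ℝ, MeasureTheory.IsProbabilityMeasure μ ∧ μ Eᶜ = 0 ∧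
      ∃ C : ℝ, 0 < C ∧ ∀ ξ : ℝ, ‖measureFourier μ ξ‖ ≤ C * (1 + |ξ|) ^ (-β / 2)}

/-- The Fourier dimension of a Borel set `E`: the supremum of a set of reals that is contained in
`[0, 1]` and contains `0` unless `E` is empty. -/
noncomputable def fourierDimension (E : Set ℝ) : ℝ := sSup (fourierDecayExponents E)

/-!
The set is the intersection of a nested sequence of finite unions of intervals, in the manner of
Jarník and Kaufman, with arithmetic independence built in through prime denominators.

A *stage* is a finite weighted family of intervals of common length `1 / L` whose left endpoints
have, in units of `1 / L`, a common denominator `D`. To refine it, each interval is assigned `K` of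
the primes in `(P, 4P]`, where `P` is huge compared with `L`, `D`, the coefficients and the number
of intervals, no prime being used twice. It is replaced by intervals shorter by a factor
`B * P ^ 4` that sit at the fractions `r / q` of its length, with `0 < r < q` and `q` one of its
primes.

*Solutions* (`Refinement.solution_trichotomy`). The four endpoints involved in a solution are
rational with a common denominator much smaller than the reciprocal of the new length, so they
satisfy an exact linear relation. Modulo a prime `q` that occurs in only one of the four
denominators this relation fails, because `q` divides neither `r` nor a coefficient nor `D`
(`prime_not_isolated`). Hence the denominators coincide in pairs. If `x₁, x₂` share theirs and
`y₁, y₂` share theirs, then all four points are close at the old scale, since `a + b = c + d`. If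
`x₁, y₁` and `x₂, y₂` are the pairs, then either `a ≠ c` and again all four points are close, or
`a = c` and `b = d`, and unless the two primes coincide (and all points are close) the numerators
agree too (`numerators_eq_of_small`), so that `x₁, y₁` and `x₂, y₂` are close at the new scale.
The third pairing is symmetric. One alternative occurs at infinitely many stages, and in the limit
it makes the solution trivial.

*Fourier decay* (`exists_refinement`). At frequency `ξ`, with `t = ξ / L`, the change of the
Fourier transform is governed by the averages of `e^{-2πitr/q}` over `r`. These are
`O(1 / ‖t‖_q)`, where `‖t‖_q` is the distance from `t` to the multiples of `q`, and an integer near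
`t` has only `O(log |t|)` prime divisors. Averaging over the nearly `P` primes therefore gains a
factor `P` up to logarithms (`sum_norm_residueMean_le`), which is `|t| ^ (1 / 4)` up to the
frequency `P ^ 4` at which the decay of the short intervals takes over. So the change is
`O(|ξ| ^ (-κ))` for every `κ < 1 / 4`, with a constant as small as desired if `P` is large; the
changes can be summed, and the weak limit of the stages (`exists_limit_measure`) has decay exponent
`β` for every `β < 1 / 2`.

*Upper bound* (`le_half_of_mem_fourierDecayExponents`). A refinement has at most `16 * P ^ 2`
intervals, of length at most `P ^ (-4)`. A probability measure carried by `N` intervals of length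
`h` charges the `h`-neighbourhood of the diagonal by at least `1 / (4 * N)`, while Fourier decay
with exponent `β < 1` bounds this by `O(h ^ β)`, through a Gaussian energy. Thus `β ≤ 1 / 2`.
-/

/-! ### The exponential and averaged exponential sums -/

/-- The character `x ↦ e^{-2πix}` of the line. -/
noncomputable def echar (x : ℝ) : ℂ := Complex.exp (-(2 * π * x : ℝ) * Complex.I)

lemma echar_eq (x : ℝ) : echar x = Complex.exp (Complex.I * (-(2 * π * x) : ℝ)) := by
  unfold echar
  congr 1
  push_cast
  ring

@[simp] lemma norm_echar (x : ℝ) : ‖echar x‖ = 1 := by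
  rw [echar_eq, Complex.norm_exp_I_mul_ofReal]

@[simp] lemma echar_zero : echar 0 = 1 := by simp [echar]

lemma echar_add (x y : ℝ) : echar (x + y) = echar x * echar y := by
  unfold echar
  rw [← Complex.exp_add]
  congr 1
  push_cast
  ring

lemma echar_intCast (k : ℤ) : echar (k : ℝ) = 1 := by
  unfold echar
  rw [Complex.exp_eq_one_iff]
  exact ⟨-k, by push_cast; ring⟩

lemma echar_nat_mul (n : ℕ) (x : ℝ) : echar (n * x) = echar x ^ n := by
  unfold echar
  rw [← Complex.exp_nat_mul]
  congr 1
  push_cast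
  ring

lemma continuous_echar : Continuous echar := by
  unfold echar
  fun_prop

lemma norm_echar_sub_one_le (x : ℝ) : ‖echar x - 1‖ ≤ 2 * π * |x| := by
  rw [echar_eq]
  refine Real.norm_exp_I_mul_ofReal_sub_one_le.trans_eq ?_
  rw [Real.norm_eq_abs, abs_neg, abs_mul, abs_of_pos Real.two_pi_pos]

lemma four_mul_abs_le_norm_one_sub_echar {x : ℝ} (hx : |x| ≤ 1 / 2) :
    4 * |x| ≤ ‖1 - echar x‖ := by
  rw [norm_sub_rev, echar_eq, Complex.norm_exp_I_mul_ofReal_sub_one, norm_mul, Real.norm_eq_abs,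
    Real.norm_eq_abs, abs_of_pos (by norm_num : (0 : ℝ) < 2)]
  have hpi := Real.pi_pos
  have h : |-(2 * π * x) / 2| = π * |x| := by
    rw [show -(2 * π * x) / 2 = -(π * x) by ring, abs_neg, abs_mul, abs_of_pos hpi]
  have := Real.mul_abs_le_abs_sin (x := -(2 * π * x) / 2) (by rw [h]; nlinarith)
  rw [h, ← mul_assoc, div_mul_cancel₀ _ hpi.ne'] at this
  linarith

lemma norm_one_sub_echar_le (x : ℝ) : ‖1 - echar x‖ ≤ 2 := by
  refine (norm_sub_le _ _).trans ?_
  simp only [norm_one, norm_echar]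
  norm_num

/-- The Fourier transform of the uniform measure on `[0, 1]`. -/
noncomputable def unitFourier (t : ℝ) : ℂ := ∫ y in (0 : ℝ)..1, echar (t * y)

lemma norm_unitFourier_le_one (t : ℝ) : ‖unitFourier t‖ ≤ 1 := by
  have := intervalIntegral.norm_integral_le_of_norm_le_const (a := (0 : ℝ)) (b := 1) (C := 1)
    (f := fun y => echar (t * y)) (fun y _ => by simp)
  simpa [unitFourier] using this

lemma norm_unitFourier_sub_one_le (t : ℝ) : ‖unitFourier t - 1‖ ≤ 2 * π * |t| := by
  have h : unitFourier t - 1 = ∫ y in (0 : ℝ)..1, (echar (t * y) - 1) := by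
    have hi : IntervalIntegrable (fun y => echar (t * y)) MeasureTheory.volume 0 1 :=
      (continuous_echar.comp (continuous_const.mul continuous_id)).intervalIntegrable _ _
    rw [intervalIntegral.integral_sub hi intervalIntegrable_const]
    simp [unitFourier]
  rw [h]
  have := intervalIntegral.norm_integral_le_of_norm_le_const (a := (0 : ℝ)) (b := 1)
    (C := 2 * π * |t|) (f := fun y => echar (t * y) - 1) (fun y hy => by
      refine (norm_echar_sub_one_le _).trans ?_
      rw [Set.uIoc_of_le zero_le_one] at hy
      rw [abs_mul, abs_of_pos hy.1]
      have := Real.pi_pos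
      have := mul_le_of_le_one_right (abs_nonneg t) hy.2
      gcongr)
  simpa using this

@[simp] lemma unitFourier_zero : unitFourier 0 = 1 := by simp [unitFourier]

lemma mul_unitFourier (t : ℝ) :
    ((2 * π * t : ℝ) * Complex.I) * unitFourier t = 1 - echar t := by
  rcases eq_or_ne t 0 with rfl | ht
  · simp
  have hc : -((2 * π * t : ℝ) : ℂ) * Complex.I ≠ 0 := by
    simp [ht, Real.pi_ne_zero]
  have h : unitFourier t
      = ∫ y in (0 : ℝ)..1, Complex.exp ((-((2 * π * t : ℝ) : ℂ) * Complex.I) * y) := by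
    unfold unitFourier echar
    congr 1
    ext y
    congr 1
    push_cast
    ring
  have he : echar t = Complex.exp (-((2 * π * t : ℝ) : ℂ) * Complex.I * (1 : ℝ)) := by
    simp [echar]
  rw [h, integral_exp_mul_complex hc, he, Complex.ofReal_zero, mul_zero, Complex.exp_zero]
  rw [show ((2 * π * t : ℝ) : ℂ) * Complex.I = -(-((2 * π * t : ℝ) : ℂ) * Complex.I) by ring,
    neg_mul, mul_div_cancel₀ _ hc, neg_sub]

lemma norm_unitFourier_mul_abs_le (t : ℝ) : ‖unitFourier t‖ * |t| ≤ 1 := by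
  have h := congrArg norm (mul_unitFourier t)
  rw [norm_mul, norm_mul, Complex.norm_I, mul_one, Complex.norm_real, Real.norm_eq_abs, abs_mul,
    abs_of_pos Real.two_pi_pos] at h
  have h2 := norm_one_sub_echar_le t
  rw [← h] at h2
  have := Real.pi_gt_three
  nlinarith [mul_nonneg (norm_nonneg (unitFourier t)) (abs_nonneg t)]

/-- The average of `e^{-2πitr/q}` over all residues `r` modulo `q`. -/
noncomputable def residueMean (q : ℕ) (t : ℝ) : ℂ :=
  (q : ℂ)⁻¹ * ∑ r ∈ Finset.range q, echar (t * (r / q))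

lemma one_sub_echar_div_mul_sum (q : ℕ) (hq : 0 < q) (t : ℝ) :
    (1 - echar (t / q)) * ∑ r ∈ Finset.range q, echar (t * (r / q)) = 1 - echar t := by
  have hq' : (q : ℝ) ≠ 0 := by positivity
  have h : ∀ r ∈ Finset.range q, echar (t * (r / q)) = echar (t / q) ^ r := by
    intro r _
    rw [← echar_nat_mul]
    congr 1
    ring
  rw [Finset.sum_congr rfl h, mul_neg_geom_sum, ← echar_nat_mul]
  congr 2
  field_simp

lemma norm_residueMean_le_one (q : ℕ) (t : ℝ) : ‖residueMean q t‖ ≤ 1 := by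
  rcases Nat.eq_zero_or_pos q with rfl | hq
  · simp [residueMean]
  unfold residueMean
  rw [norm_mul, norm_inv, Complex.norm_natCast, inv_mul_le_iff₀ (by positivity), mul_one]
  refine (norm_sum_le _ _).trans ?_
  simp

/-- The exponential sum over all residues is small away from the multiples `q * k` of `q`. -/
lemma norm_residueMean_mul_abs_sub_le (q : ℕ) (hq : 0 < q) (t : ℝ) (k : ℤ)
    (h : |t - q * k| ≤ q / 2) : ‖residueMean q t‖ * (2 * |t - q * k|) ≤ 1 := by
  have hq' : (0 : ℝ) < q := by positivity
  have he : echar (t / q) = echar ((t - q * k) / q) := by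
    have : t / q = (t - q * k) / q + k := by field_simp; ring
    rw [this, echar_add, echar_intCast, mul_one]
  have h1 := congrArg norm (one_sub_echar_div_mul_sum q hq t)
  rw [norm_mul, he] at h1
  have habs : |(t - q * k) / q| = |t - q * k| / q := by rw [abs_div, abs_of_pos hq']
  have h2 := four_mul_abs_le_norm_one_sub_echar (x := (t - q * k) / q) (by
    rw [habs, div_le_iff₀ hq']; linarith)
  rw [habs] at h2
  have h3 := norm_one_sub_echar_le t
  unfold residueMean
  rw [norm_mul, norm_inv, Complex.norm_natCast]
  set N := ‖∑ r ∈ Finset.range q, echar (t * (r / q))‖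
  have hN : 0 ≤ N := norm_nonneg _
  have h4 : 4 * (|t - q * k| / q) * N ≤ 2 :=
    (mul_le_mul_of_nonneg_right h2 hN).trans (h1.trans_le h3)
  calc (q : ℝ)⁻¹ * N * (2 * |t - q * k|) = (4 * (|t - q * k| / q) * N) / 2 := by
        field_simp; ring
    _ ≤ 1 := by linarith

/-- Subdividing `[0, 1]` into `q` equal parts. -/
lemma unitFourier_eq_residueMean_mul (q : ℕ) (hq : 0 < q) (t : ℝ) :
    unitFourier t = residueMean q t * unitFourier (t / q) := by
  have hq' : (q : ℂ) ≠ 0 := by exact_mod_cast hq.ne'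
  rcases eq_or_ne t 0 with rfl | ht
  · simp [residueMean, hq']
  have hc : ((2 * π * t : ℝ) : ℂ) * Complex.I ≠ 0 := by
    simp [ht, Real.pi_ne_zero]
  apply mul_left_cancel₀ hc
  rw [mul_unitFourier, ← one_sub_echar_div_mul_sum q hq t, ← mul_unitFourier (t / q)]
  unfold residueMean
  push_cast
  field_simp

/-- The average of `e^{-2πitr/q}` over the nonzero residues `r` modulo `q`. -/
noncomputable def nonzeroResidueMean (q : ℕ) (t : ℝ) : ℂ :=
  ((q - 1 : ℕ) : ℂ)⁻¹ * ∑ r ∈ Finset.range (q - 1), echar (t * ((r + 1 : ℕ) / q))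

lemma nonzeroResidueMean_eq (q : ℕ) (hq : 2 ≤ q) (t : ℝ) :
    nonzeroResidueMean q t
      = residueMean q t + ((q - 1 : ℕ) : ℂ)⁻¹ * (residueMean q t - 1) := by
  obtain ⟨n, rfl⟩ : ∃ n, q = n + 1 := ⟨q - 1, by omega⟩
  have hn : (n : ℂ) ≠ 0 := by
    have : n ≠ 0 := by omega
    exact_mod_cast this
  have hn' : (n : ℂ) + 1 ≠ 0 := by exact_mod_cast (by omega : n + 1 ≠ 0)
  unfold nonzeroResidueMean residueMean
  rw [Finset.sum_range_succ']
  simp only [Nat.add_sub_cancel, Nat.cast_zero, zero_div, mul_zero, echar_zero]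
  push_cast
  field_simp
  ring

lemma inv_pred_le (q : ℕ) (hq : 2 ≤ q) : ((q - 1 : ℕ) : ℝ)⁻¹ ≤ 2 / q := by
  have h : (q : ℝ) ≤ 2 * (q - 1 : ℕ) := by
    have : q ≤ 2 * (q - 1) := by omega
    exact_mod_cast this
  have h1 : (0 : ℝ) < (q - 1 : ℕ) := by exact_mod_cast (by omega : 0 < q - 1)
  rw [inv_eq_one_div, div_le_div_iff₀ h1 (by positivity)]
  linarith

lemma norm_nonzeroResidueMean_le (q : ℕ) (hq : 2 ≤ q) (t : ℝ) :
    ‖nonzeroResidueMean q t‖ ≤ 2 * ‖residueMean q t‖ + 2 / q := by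
  have h1 := inv_pred_le q hq
  have h2 : (2 : ℝ) / q ≤ 1 := by
    rw [div_le_one (by positivity)]
    exact_mod_cast hq
  have h3 : (0 : ℝ) ≤ ((q - 1 : ℕ) : ℝ)⁻¹ := by positivity
  rw [nonzeroResidueMean_eq q hq]
  refine (norm_add_le _ _).trans ?_
  rw [norm_mul, norm_inv, Complex.norm_natCast]
  have h4 : ‖residueMean q t - 1‖ ≤ ‖residueMean q t‖ + 1 := by
    simpa using norm_sub_le (residueMean q t) 1
  have h5 : ((q - 1 : ℕ) : ℝ)⁻¹ * ‖residueMean q t - 1‖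
      ≤ 1 * ‖residueMean q t‖ + 2 / q * 1 := by
    calc _ ≤ ((q - 1 : ℕ) : ℝ)⁻¹ * (‖residueMean q t‖ + 1) := by gcongr
      _ = ((q - 1 : ℕ) : ℝ)⁻¹ * ‖residueMean q t‖ + ((q - 1 : ℕ) : ℝ)⁻¹ * 1 := by ring
      _ ≤ _ := by gcongr; exact h1.trans h2
  linarith

/-- At low frequencies, replacing the uniform measure on `[0, 1]` by short intervals at the
nonzero fractions with denominator `q` costs only `O(1 / q)`. -/
lemma norm_nonzeroResidueMean_mul_sub_le (q : ℕ) (hq : 2 ≤ q) (M : ℝ) (hM : q ≤ M) (t : ℝ)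
    (ht : |t| ≤ q / 2) :
    ‖nonzeroResidueMean q t * unitFourier (t / M) - unitFourier t‖ ≤ 12 / q := by
  have hq0 : (0 : ℝ) < q := by positivity
  have hM0 : 0 < M := hq0.trans_le hM
  have e1 : nonzeroResidueMean q t * unitFourier (t / M) - unitFourier t
      = residueMean q t * ((unitFourier (t / M) - 1) - (unitFourier (t / q) - 1))
        + ((q - 1 : ℕ) : ℂ)⁻¹ * (residueMean q t - 1) * unitFourier (t / M) := by
    rw [nonzeroResidueMean_eq q hq, unitFourier_eq_residueMean_mul q (by omega) t]
    ring
  rw [e1]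
  refine (norm_add_le _ _).trans ?_
  rw [norm_mul, norm_mul, norm_mul, norm_inv, Complex.norm_natCast]
  have hU := norm_residueMean_mul_abs_sub_le q (by omega) t 0 (by simpa using ht)
  simp only [Int.cast_zero, mul_zero, sub_zero] at hU
  have hpi := Real.pi_pos
  have b1 : ‖(unitFourier (t / M) - 1) - (unitFourier (t / q) - 1)‖ ≤ 2 * |t| * (2 * π / q) := by
    refine (norm_sub_le _ _).trans ?_
    have h1 := norm_unitFourier_sub_one_le (t / M)
    have h2 := norm_unitFourier_sub_one_le (t / q)
    rw [abs_div, abs_of_pos hM0] at h1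
    rw [abs_div, abs_of_pos hq0] at h2
    have h3 : |t| / M ≤ |t| / q := by gcongr
    have h4 : 2 * π * (|t| / M) ≤ 2 * π * (|t| / q) := by gcongr
    calc _ ≤ 2 * π * (|t| / q) + 2 * π * (|t| / q) := by linarith
      _ = _ := by ring
  have b2 : ‖residueMean q t - 1‖ ≤ 2 := by
    refine (norm_sub_le _ _).trans ?_
    have := norm_residueMean_le_one q t
    rw [norm_one]
    linarith
  have b3 := norm_unitFourier_le_one (t / M)
  have b4 := inv_pred_le q hq
  have c1 : ‖residueMean q t‖ * ‖(unitFourier (t / M) - 1) - (unitFourier (t / q) - 1)‖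
      ≤ 2 * π / q := by
    calc _ ≤ ‖residueMean q t‖ * (2 * |t| * (2 * π / q)) := by gcongr
      _ = (‖residueMean q t‖ * (2 * |t|)) * (2 * π / q) := by ring
      _ ≤ 1 * (2 * π / q) := by gcongr
      _ = _ := one_mul _
  have c2 : ((q - 1 : ℕ) : ℝ)⁻¹ * ‖residueMean q t - 1‖ * ‖unitFourier (t / M)‖
      ≤ 2 / q * 2 * 1 := by gcongr
  have c3 : 2 * π / q + 2 / q * 2 * 1 ≤ 12 / q := by
    rw [show 2 * π / q + 2 / q * 2 * 1 = (2 * π + 4) / q by ring]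
    gcongr
    linarith [Real.pi_lt_four]
  linarith

/-! ### Exponential sums averaged over prime denominators -/

lemma two_pow_card_le_abs (A : Finset ℕ) (hA : ∀ q ∈ A, q.Prime) (m : ℤ) (hm : m ≠ 0)
    (hd : ∀ q ∈ A, (q : ℤ) ∣ m) : (2 : ℝ) ^ A.card ≤ |(m : ℝ)| := by
  have h1 : ∏ q ∈ A, q ∣ m.natAbs :=
    Finset.prod_primes_dvd _ (fun q hq => (hA q hq).prime) fun q hq =>
      Int.natCast_dvd.mp (hd q hq)
  have h2 : 2 ^ A.card ≤ ∏ q ∈ A, q :=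
    Finset.pow_card_le_prod A (fun q => q) 2 fun q hq => (hA q hq).two_le
  have h3 := h2.trans (Nat.le_of_dvd (Int.natAbs_pos.mpr hm) h1)
  rw [← Int.cast_abs, Int.abs_eq_natAbs]
  exact_mod_cast h3

lemma sum_Icc_one_div_le (n : ℕ) :
    ∑ i ∈ Finset.Icc (-(n : ℤ)) n, 2 / (1 + |(i : ℝ)|) ≤ 4 * (1 + Real.log (n + 1)) := by
  have hsub : Finset.Icc (-(n : ℤ)) n ⊆
      (Finset.range (n + 1)).image (fun j : ℕ => (j : ℤ)) ∪
        (Finset.range (n + 1)).image (fun j : ℕ => -(j : ℤ)) := by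
    intro i hi
    rw [Finset.mem_Icc] at hi
    simp only [Finset.mem_union, Finset.mem_image, Finset.mem_range]
    rcases le_total 0 i with h | h
    · exact Or.inl ⟨i.toNat, by omega, by omega⟩
    · exact Or.inr ⟨(-i).toNat, by omega, by omega⟩
  have hpos : ∀ i : ℤ, 0 ≤ 2 / (1 + |(i : ℝ)|) := fun i => by positivity
  have hharm : ∑ j ∈ Finset.range (n + 1), (2 : ℝ) / (1 + j) ≤ 2 * (1 + Real.log (n + 1)) := by
    have h := harmonic_le_one_add_log (n + 1)
    rw [harmonic_eq_sum_Icc, Finset.range_eq_Ico] at *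
    rw [show ∑ j ∈ Finset.Ico 0 (n + 1), (2 : ℝ) / (1 + j)
        = 2 * ((∑ i ∈ Finset.Icc 1 (n + 1), (i : ℚ)⁻¹ : ℚ) : ℝ) by
      push_cast
      rw [Finset.mul_sum, ← Finset.Ico_add_one_right_eq_Icc, Finset.sum_Ico_eq_sum_range,
        Finset.sum_Ico_eq_sum_range]
      refine Finset.sum_congr (by simp) fun i _ => ?_
      push_cast
      ring]
    push_cast at h ⊢
    linarith
  calc _ ≤ ∑ i ∈ (Finset.range (n + 1)).image (fun j : ℕ => (j : ℤ)) ∪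
        (Finset.range (n + 1)).image (fun j : ℕ => -(j : ℤ)), 2 / (1 + |(i : ℝ)|) :=
        Finset.sum_le_sum_of_subset_of_nonneg hsub fun i _ _ => hpos i
    _ ≤ ∑ i ∈ (Finset.range (n + 1)).image (fun j : ℕ => (j : ℤ)), 2 / (1 + |(i : ℝ)|)
        + ∑ i ∈ (Finset.range (n + 1)).image (fun j : ℕ => -(j : ℤ)), 2 / (1 + |(i : ℝ)|) := by
        rw [← Finset.sum_union_inter]
        exact le_add_of_nonneg_right (Finset.sum_nonneg fun i _ => hpos i)
    _ = ∑ j ∈ Finset.range (n + 1), (2 : ℝ) / (1 + j)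
        + ∑ j ∈ Finset.range (n + 1), (2 : ℝ) / (1 + j) := by
        rw [Finset.sum_image (by simp), Finset.sum_image (by simp)]
        simp
    _ ≤ _ := by linarith

lemma le_two_div_of_mul_le_one {u x : ℝ} {j : ℤ} (hu1 : u ≤ 1) (hu : u * (2 * x) ≤ 1)
    (hx : |(j : ℝ)| ≤ x + 1) : u ≤ 2 / (1 + |(j : ℝ)|) := by
  rw [le_div_iff₀ (by positivity)]
  rcases le_or_gt |j| 1 with h | h
  · have h' : |(j : ℝ)| ≤ 1 := by exact_mod_cast h
    nlinarith [abs_nonneg (j : ℝ)]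
  · have h' : 2 ≤ |(j : ℝ)| := by exact_mod_cast h
    rcases le_or_gt u 0 with h0 | h0
    · nlinarith
    · nlinarith

/-- Averaged over primes `q` of size about `P`, the sums over all residues modulo `q` save almost
a full factor `P` at every frequency `|t| ≥ P / 2`: an integer near `t` has only logarithmically
many prime divisors, so `t` is close to a nonzero multiple of `q` for few `q`. -/
lemma sum_norm_residueMean_le (P : ℕ) (hP : 1 ≤ P) (A : Finset ℕ)
    (hA : ∀ q ∈ A, q.Prime ∧ P < q ∧ q ≤ 4 * P) (t : ℝ) (ht : (P : ℝ) / 2 ≤ |t|)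
    (ht1 : 1 ≤ |t|) :
    ∑ q ∈ A, ‖residueMean q t‖ ≤ 12 * (1 + Real.log (6 * |t|)) ^ 2 := by
  classical
  have hP0 : (0 : ℝ) < P := by exact_mod_cast hP
  have hnear : ∀ q ∈ A, |t - q * (round (t / q) : ℤ)| ≤ q / 2 := by
    intro q hq
    have hq0 : (0 : ℝ) < q := by exact_mod_cast (hA q hq).1.pos
    have h := abs_sub_round (t / q)
    have e : t - q * (round (t / q) : ℤ) = q * (t / q - (round (t / q) : ℤ)) := by field_simp
    rw [e, abs_mul, abs_of_pos hq0]
    nlinarith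
  have hU : ∀ q ∈ A, ‖residueMean q t‖ * (2 * |t - q * (round (t / q) : ℤ)|) ≤ 1 :=
    fun q hq => norm_residueMean_mul_abs_sub_le q (hA q hq).1.pos t _ (hnear q hq)
  have hlog : 0 ≤ Real.log (6 * |t|) := Real.log_nonneg (by linarith)
  rw [← Finset.sum_filter_add_sum_filter_not A (fun q : ℕ => round (t / q) = 0)]
  -- If the nearest multiple of `q` is `0`, then `t` is at distance at least `P / 2` from it.
  have hzero : ∑ q ∈ A.filter (fun q : ℕ => round (t / q) = 0), ‖residueMean q t‖ ≤ 4 := by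
    have hcard : ((A.filter (fun q : ℕ => round (t / q) = 0)).card : ℝ) ≤ 4 * P := by
      have : (A.filter (fun q : ℕ => round (t / q) = 0)) ⊆ Finset.Icc 1 (4 * P) := by
        intro q hq
        have := hA q (Finset.mem_filter.mp hq).1
        rw [Finset.mem_Icc]
        omega
      have := Finset.card_le_card this
      rw [Nat.card_Icc, Nat.add_sub_cancel] at this
      exact_mod_cast this
    calc _ ≤ ∑ q ∈ A.filter (fun q : ℕ => round (t / q) = 0), 1 / (P : ℝ) := by
          refine Finset.sum_le_sum fun q hq => ?_
          obtain ⟨hqA, hq0⟩ := Finset.mem_filter.mp hq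
          have h := hU q hqA
          rw [hq0, Int.cast_zero, mul_zero, sub_zero] at h
          rw [le_div_iff₀ hP0]
          nlinarith [norm_nonneg (residueMean q t)]
      _ = (A.filter (fun q : ℕ => round (t / q) = 0)).card * (1 / (P : ℝ)) := by
          rw [Finset.sum_const, nsmul_eq_mul]
      _ ≤ 4 * P * (1 / P) := by gcongr
      _ = 4 := by field_simp
  -- The other primes are sorted by the offset `i` from `⌊t⌋` to the multiple of `q` nearest `t`.
  -- Those with a common offset all divide the nonzero integer `⌊t⌋ + i`, so they are few.
  set A' := A.filter (fun q : ℕ => ¬ round (t / q) = 0) with hA'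
  set f : ℕ → ℤ := fun q => q * round (t / q) - ⌊t⌋ with hf
  set n : ℕ := 2 * P + 1 with hn
  have hfdist : ∀ q ∈ A, |(f q : ℝ)| ≤ |t - q * (round (t / q) : ℤ)| + 1 := by
    intro q _
    have e : (f q : ℝ) = -(t - q * (round (t / q) : ℤ)) + (t - ⌊t⌋) := by
      rw [hf]; push_cast; ring
    rw [e]
    refine (abs_add_le _ _).trans ?_
    rw [abs_neg]
    have h1 := Int.floor_le t
    have h2 := Int.lt_floor_add_one t
    gcongr
    rw [abs_le]
    constructor <;> linarith
  have hq2P : ∀ q ∈ A, (q : ℝ) / 2 ≤ 2 * P := by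
    intro q hq
    have : (q : ℝ) ≤ 4 * P := by exact_mod_cast (hA q hq).2.2
    linarith
  have hmaps : ∀ q ∈ A', f q ∈ Finset.Icc (-(n : ℤ)) n := by
    intro q hq
    have hqA := (Finset.mem_filter.mp hq).1
    have h := (hfdist q hqA).trans
      (by linarith [hnear q hqA, hq2P q hqA] : _ ≤ (2 * P + 1 : ℝ))
    have h' : |f q| ≤ (n : ℤ) := by
      rw [hn]
      exact_mod_cast h
    rw [Finset.mem_Icc]
    exact abs_le.mp h'
  have hfiber : ∀ i : ℤ, ((A'.filter fun q => f q = i).card : ℝ) ≤ 2 * Real.log (6 * |t|) := by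
    intro i
    rcases Finset.eq_empty_or_nonempty (A'.filter fun q => f q = i) with h0 | ⟨q₀, hq₀⟩
    · rw [h0]; simpa using hlog
    have key : ∀ q ∈ A'.filter (fun q => f q = i),
        (q : ℤ) * round (t / q) = i + ⌊t⌋ := by
      intro q hq
      have := (Finset.mem_filter.mp hq).2
      simp only [hf] at this
      linarith
    have hmem : ∀ q ∈ A'.filter (fun q => f q = i), q ∈ A :=
      fun q hq => (Finset.mem_filter.mp (Finset.mem_filter.mp hq).1).1
    have hne : i + ⌊t⌋ ≠ 0 := by
      rw [← key q₀ hq₀]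
      refine mul_ne_zero ?_ (Finset.mem_filter.mp (Finset.mem_filter.mp hq₀).1).2
      exact_mod_cast (hA q₀ (hmem q₀ hq₀)).1.pos.ne'
    have h1 := two_pow_card_le_abs (A'.filter fun q => f q = i)
      (fun q hq => (hA q (hmem q hq)).1) (i + ⌊t⌋) hne
      (fun q hq => ⟨_, (key q hq).symm⟩)
    have h2 : |((i + ⌊t⌋ : ℤ) : ℝ)| ≤ 6 * |t| := by
      rw [← key q₀ hq₀]
      have h3 := hnear q₀ (hmem q₀ hq₀)
      have h4 := hq2P q₀ (hmem q₀ hq₀)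
      push_cast
      have := abs_sub_abs_le_abs_sub ((q₀ : ℝ) * (round (t / q₀) : ℤ)) t
      rw [abs_sub_comm] at this
      linarith
    have h5 := Real.log_le_log (by positivity) (h1.trans h2)
    rw [Real.log_pow] at h5
    have := Real.log_two_gt_d9
    nlinarith [Nat.cast_nonneg (α := ℝ) (A'.filter fun q => f q = i).card]
  have hrest : ∑ q ∈ A', ‖residueMean q t‖
      ≤ 2 * Real.log (6 * |t|) * (4 * (1 + Real.log (6 * |t|))) := by
    rw [← Finset.sum_fiberwise_of_maps_to hmaps]
    calc _ ≤ ∑ i ∈ Finset.Icc (-(n : ℤ)) n,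
          2 * Real.log (6 * |t|) * (2 / (1 + |(i : ℝ)|)) := by
          refine Finset.sum_le_sum fun i _ => ?_
          calc _ ≤ ∑ q ∈ A'.filter (fun q => f q = i), 2 / (1 + |(i : ℝ)|) := by
                refine Finset.sum_le_sum fun q hq => ?_
                obtain ⟨hqA', hqi⟩ := Finset.mem_filter.mp hq
                have hqA := (Finset.mem_filter.mp hqA').1
                have := le_two_div_of_mul_le_one (norm_residueMean_le_one q t) (hU q hqA)
                  (hfdist q hqA)
                rwa [hqi] at this
            _ = (A'.filter fun q => f q = i).card * (2 / (1 + |(i : ℝ)|)) := by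
                rw [Finset.sum_const, nsmul_eq_mul]
            _ ≤ _ := by
                gcongr
                exact hfiber i
      _ = 2 * Real.log (6 * |t|) * ∑ i ∈ Finset.Icc (-(n : ℤ)) n, 2 / (1 + |(i : ℝ)|) := by
          rw [Finset.mul_sum]
      _ ≤ 2 * Real.log (6 * |t|) * (4 * (1 + Real.log (n + 1))) := by
          gcongr
          exact sum_Icc_one_div_le n
      _ ≤ _ := by
          have : (n : ℝ) + 1 ≤ 6 * |t| := by
            rw [hn]; push_cast; linarith
          gcongr
  nlinarith

/-- A weak form of Chebyshev's lower bound for the primes in `(n, 4n]`. The factor `4` makes the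
elementary bounds `θ(4n) ≥ 4n log 2 - o(n)` and `θ(n) ≤ n log 4` sufficient. -/
lemma eventually_card_primes_ge :
    ∀ᶠ n : ℕ in Filter.atTop,
      (n : ℝ) / Real.log (4 * n) ≤ ((Finset.Ioc n (4 * n)).filter Nat.Prime).card := by
  have h1 : ∀ᶠ x : ℝ in Filter.atTop,
      Real.log (4 * x + 1) + 2 * √(4 * x) * Real.log (4 * x) ≤ (2 * Real.log 2 - 1) * x := by
    have e1 : (fun x : ℝ => Real.log (4 * x + 1)) =o[Filter.atTop] (fun x : ℝ => x) := by
      have ht : Filter.Tendsto (fun x : ℝ => 4 * x + 1) Filter.atTop Filter.atTop :=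
        Filter.tendsto_atTop_add_const_right _ _
          (Filter.tendsto_id.const_mul_atTop (by norm_num))
      have := Real.isLittleO_log_id_atTop.comp_tendsto ht
      refine this.trans_isBigO ?_
      refine Asymptotics.IsBigO.of_bound 5 ?_
      filter_upwards [Filter.eventually_ge_atTop 1] with x hx
      simp only [Function.comp, id, Real.norm_eq_abs]
      rw [abs_of_nonneg (by linarith), abs_of_nonneg (by linarith)]
      linarith
    have e2 : (fun x : ℝ => 2 * √(4 * x) * Real.log (4 * x)) =o[Filter.atTop]
        (fun x : ℝ => x) := by
      have ht : Filter.Tendsto (fun x : ℝ => 4 * x) Filter.atTop Filter.atTop :=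
        Filter.tendsto_id.const_mul_atTop (by norm_num)
      have h := (isLittleO_log_rpow_atTop (by norm_num : (0 : ℝ) < 1 / 2)).comp_tendsto ht
      have h' : (fun x : ℝ => 2 * √(4 * x) * Real.log (4 * x)) =o[Filter.atTop]
          (fun x : ℝ => 2 * √(4 * x) * (4 * x) ^ (1 / 2 : ℝ)) :=
        (Asymptotics.isBigO_refl _ _).mul_isLittleO h
      refine h'.trans_isBigO (Asymptotics.IsBigO.of_bound 8 ?_)
      filter_upwards [Filter.eventually_ge_atTop 1] with x hx
      rw [← Real.sqrt_eq_rpow, mul_assoc, Real.mul_self_sqrt (by linarith)]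
      simp only [Real.norm_eq_abs]
      rw [abs_of_nonneg (by linarith), abs_of_nonneg (by linarith)]
      linarith
    have hc : 0 < 2 * Real.log 2 - 1 := by linarith [Real.log_two_gt_d9]
    filter_upwards [(e1.add e2).bound hc, Filter.eventually_ge_atTop 0] with x hx hx0
    rw [Real.norm_eq_abs, Real.norm_eq_abs, abs_of_nonneg hx0] at hx
    exact (le_abs_self _).trans hx
  filter_upwards [tendsto_natCast_atTop_atTop.eventually h1, Filter.eventually_ge_atTop 1]
    with n hn hn1
  have hn0 : (1 : ℝ) ≤ n := by exact_mod_cast hn1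
  have hlogpos : 0 < Real.log (4 * n) := Real.log_pos (by linarith)
  rw [div_le_iff₀ hlogpos]
  have lower := Chebyshev.theta_ge (4 * n)
  have upper := Chebyshev.theta_le_log4_mul_x (x := (n : ℝ)) (by linarith)
  have hlog4 : Real.log 4 = 2 * Real.log 2 := by
    rw [show (4 : ℝ) = 2 ^ 2 by norm_num, Real.log_pow]; norm_num
  have split : Chebyshev.theta ((4 * n : ℕ) : ℝ) - Chebyshev.theta (n : ℝ)
      = ∑ p ∈ (Finset.Ioc n (4 * n)).filter Nat.Prime, Real.log p := by
    unfold Chebyshev.theta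
    rw [Nat.floor_natCast, Nat.floor_natCast, sub_eq_iff_eq_add']
    rw [← Finset.sum_union]
    · congr 1
      rw [← Finset.filter_union, Finset.Ioc_union_Ioc_eq_Ioc (by omega) (by omega)]
    · exact Finset.disjoint_filter_filter (Finset.Ioc_disjoint_Ioc_of_le le_rfl)
  have bound : ∑ p ∈ (Finset.Ioc n (4 * n)).filter Nat.Prime, Real.log p
      ≤ ((Finset.Ioc n (4 * n)).filter Nat.Prime).card * Real.log (4 * n) := by
    rw [← nsmul_eq_mul]
    refine Finset.sum_le_card_nsmul _ _ _ fun p hp => ?_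
    have hp' := Finset.mem_Ioc.mp (Finset.mem_filter.mp hp).1
    apply Real.log_le_log
    · exact_mod_cast (by omega : 0 < p)
    · exact_mod_cast hp'.2
  push_cast at lower
  rw [hlog4] at upper
  push_cast at split
  nlinarith

/-! ### Stages of the construction and their refinements -/

/-- A stage of the construction: finitely many weighted intervals `[pos i, pos i + 1 / scale]`
inside `[0, 1]`. In units of `1 / scale`, the left endpoints are rational with the common
denominator `denom`. -/
structure Stage where
  ι : Type
  fintype : Fintype ι
  pos : ι → ℝ
  weight : ι → ℝ
  scale : ℕ
  denom : ℕ
  scale_pos : 0 < scale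
  denom_pos : 0 < denom
  weight_nonneg : ∀ i, 0 ≤ weight i
  sum_weight : ∑ i, weight i = 1
  pos_nonneg : ∀ i, 0 ≤ pos i
  pos_add_le : ∀ i, pos i + 1 / scale ≤ 1
  rational : ∀ i, ∃ k : ℤ, (denom : ℝ) * (scale * pos i) = k

attribute [instance] Stage.fintype

namespace Stage

/-- The union of the intervals of a stage. -/
def carrier (S : Stage) : Set ℝ := ⋃ i, Set.Icc (S.pos i) (S.pos i + 1 / S.scale)

/-- The Fourier transform of the probability measure that gives the `i`-th interval mass
`weight i`, spread uniformly. -/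
noncomputable def fourier (S : Stage) (ξ : ℝ) : ℂ :=
  (∑ i, (S.weight i : ℂ) * echar (S.pos i * ξ)) * unitFourier (ξ / S.scale)

lemma mem_carrier {S : Stage} {x : ℝ} :
    x ∈ S.carrier ↔ ∃ i, S.pos i ≤ x ∧ x ≤ S.pos i + 1 / S.scale := by
  simp [carrier]

lemma pos_mem_carrier (S : Stage) (i : S.ι) : S.pos i ∈ S.carrier :=
  mem_carrier.mpr ⟨i, le_rfl, le_add_of_nonneg_right (by positivity)⟩

lemma carrier_subset_Icc (S : Stage) : S.carrier ⊆ Set.Icc 0 1 := by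
  intro x hx
  obtain ⟨i, h1, h2⟩ := mem_carrier.mp hx
  exact ⟨(S.pos_nonneg i).trans h1, h2.trans (S.pos_add_le i)⟩

lemma isClosed_carrier (S : Stage) : IsClosed S.carrier :=
  isClosed_iUnion_of_finite fun _ => isClosed_Icc

lemma weight_le_one (S : Stage) (i : S.ι) : S.weight i ≤ 1 := by
  rw [← S.sum_weight]
  exact Finset.single_le_sum (fun j _ => S.weight_nonneg j) (Finset.mem_univ i)

lemma nonempty (S : Stage) : Nonempty S.ι := by
  by_contra h
  rw [not_nonempty_iff] at h
  have := S.sum_weight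
  simp at this

/-- The initial stage: the single interval `[0, 1]`. -/
def initial : Stage where
  ι := Unit
  fintype := inferInstance
  pos := fun _ => 0
  weight := fun _ => 1
  scale := 1
  denom := 1
  scale_pos := one_pos
  denom_pos := one_pos
  weight_nonneg := fun _ => zero_le_one
  sum_weight := by simp
  pos_nonneg := fun _ => le_rfl
  pos_add_le := fun _ => by norm_num
  rational := fun _ => ⟨0, by simp⟩

end Stage

/-- The choices made in refining a stage: each interval is assigned `K` primes between `P` and
`4 * P`, all different, and is replaced by intervals that are `B * P ^ 4` times shorter, located
at the nonzero fractions having one of these primes as denominator. Four such fractions have a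
common denominator at most `(4 * P) ^ 4`, so a relation between four of the new intervals is an
exact relation between their left endpoints once `B` is large. -/
structure Refinement (S : Stage) where
  P : ℕ
  K : ℕ
  B : ℕ
  q : S.ι × Fin K → ℕ
  P_pos : 0 < P
  K_pos : 0 < K
  four_le_B : 4 ≤ B
  injective : Function.Injective q
  prime : ∀ x, (q x).Prime
  lt_q : ∀ x, P < q x
  q_le : ∀ x, q x ≤ 4 * P

namespace Refinement

variable {S : Stage} (R : Refinement S)

/-- The factor by which a refinement shortens the intervals. -/
def ratio : ℕ := R.B * R.P ^ 4

lemma q_le_ratio (x : S.ι × Fin R.K) : R.q x ≤ R.ratio := by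
  have h1 := R.q_le x
  have h2 : R.P ^ 1 ≤ R.P ^ 4 := Nat.pow_le_pow_right R.P_pos (by norm_num)
  have h3 := Nat.mul_le_mul R.four_le_B h2
  unfold ratio
  rw [pow_one] at h3
  exact h1.trans h3

lemma ratio_pos : 0 < R.ratio :=
  Nat.mul_pos (by have := R.four_le_B; omega) (pow_pos R.P_pos 4)

/-- The left endpoint of the interval at the fraction `(r + 1) / q x`. -/
noncomputable def nextPos (i : Σ x : S.ι × Fin R.K, Fin (R.q x - 1)) : ℝ :=
  S.pos i.1.1 + ((i.2 + 1 : ℕ) / (R.q i.1 : ℝ)) / S.scale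

lemma frac_add_le (x : S.ι × Fin R.K) (r : Fin (R.q x - 1)) :
    ((r + 1 : ℕ) / (R.q x : ℝ)) + 1 / R.ratio ≤ 1 := by
  have hq : (0 : ℝ) < R.q x := by exact_mod_cast (R.prime x).pos
  have h1 : (1 : ℝ) / R.ratio ≤ 1 / R.q x := by
    apply one_div_le_one_div_of_le hq
    exact_mod_cast R.q_le_ratio x
  have h2 : ((r + 1 : ℕ) : ℝ) + 1 ≤ R.q x := by
    have := r.2
    exact_mod_cast (by omega : (r : ℕ) + 1 + 1 ≤ R.q x)
  calc _ ≤ ((r + 1 : ℕ) / (R.q x : ℝ)) + 1 / R.q x := by gcongr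
    _ = (((r + 1 : ℕ) : ℝ) + 1) / R.q x := by ring
    _ ≤ 1 := (div_le_one hq).mpr h2

lemma nextPos_add_le (i : Σ x : S.ι × Fin R.K, Fin (R.q x - 1)) :
    R.nextPos i + 1 / (S.scale * R.ratio : ℕ) ≤ S.pos i.1.1 + 1 / S.scale := by
  have h := R.frac_add_le i.1 i.2
  have hL : (0 : ℝ) < S.scale := by exact_mod_cast S.scale_pos
  have hM : (0 : ℝ) < R.ratio := by exact_mod_cast R.ratio_pos
  calc _ = S.pos i.1.1 + (((i.2 + 1 : ℕ) / (R.q i.1 : ℝ)) + 1 / R.ratio) / S.scale := by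
        unfold nextPos; push_cast; field_simp; ring
    _ ≤ _ := by gcongr

lemma pos_le_nextPos (i : Σ x : S.ι × Fin R.K, Fin (R.q x - 1)) :
    S.pos i.1.1 ≤ R.nextPos i :=
  le_add_of_nonneg_right (by positivity)

lemma sum_nextWeight_fiber {α : Type*} [AddCommGroup α] [Module ℝ α]
    (x : S.ι × Fin R.K) (c : ℝ) (v : α) :
    ∑ _r : Fin (R.q x - 1), (c / (R.K * (R.q x - 1 : ℕ))) • v = (c / R.K) • v := by
  have h1 : ((R.q x - 1 : ℕ) : ℝ) ≠ 0 := by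
    have := (R.prime x).two_le
    exact_mod_cast (by omega : R.q x - 1 ≠ 0)
  rw [Finset.sum_const, Finset.card_univ, Fintype.card_fin, ← Nat.cast_smul_eq_nsmul ℝ,
    smul_smul]
  congr 1
  field_simp

lemma sum_weight_div : ∑ x : S.ι × Fin R.K, S.weight x.1 / R.K = 1 := by
  have h1 : (R.K : ℝ) ≠ 0 := by exact_mod_cast R.K_pos.ne'
  rw [Fintype.sum_prod_type, ← S.sum_weight]
  refine Finset.sum_congr rfl fun i _ => ?_
  dsimp only
  rw [Finset.sum_const, Finset.card_univ, Fintype.card_fin, nsmul_eq_mul]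
  field_simp

/-- The refined stage. -/
noncomputable def next : Stage where
  ι := Σ x : S.ι × Fin R.K, Fin (R.q x - 1)
  fintype := inferInstance
  pos := R.nextPos
  weight := fun i => S.weight i.1.1 / (R.K * (R.q i.1 - 1 : ℕ))
  scale := S.scale * R.ratio
  denom := S.denom * ∏ x, R.q x
  scale_pos := Nat.mul_pos S.scale_pos R.ratio_pos
  denom_pos := Nat.mul_pos S.denom_pos (Finset.prod_pos fun x _ => (R.prime x).pos)
  weight_nonneg := fun i => div_nonneg (S.weight_nonneg _) (by positivity)
  sum_weight := by
    rw [Fintype.sum_sigma, ← R.sum_weight_div]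
    refine Finset.sum_congr rfl fun x _ => ?_
    simpa using R.sum_nextWeight_fiber x (S.weight x.1) (1 : ℝ)
  pos_nonneg := fun i => (S.pos_nonneg _).trans (R.pos_le_nextPos i)
  pos_add_le := fun i => (R.nextPos_add_le i).trans (S.pos_add_le _)
  rational := by
    intro i
    obtain ⟨k, hk⟩ := S.rational i.1.1
    obtain ⟨m, hm⟩ : R.q i.1 ∣ ∏ x, R.q x := Finset.dvd_prod_of_mem _ (Finset.mem_univ _)
    have hq : (R.q i.1 : ℝ) ≠ 0 := by exact_mod_cast (R.prime i.1).pos.ne'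
    have hL : (S.scale : ℝ) ≠ 0 := by exact_mod_cast S.scale_pos.ne'
    refine ⟨R.ratio * (R.q i.1 * m) * k + S.denom * R.ratio * (i.2 + 1 : ℕ) * m, ?_⟩
    rw [hm]
    unfold nextPos
    push_cast
    rw [← hk]
    field_simp

lemma carrier_next_subset : R.next.carrier ⊆ S.carrier := by
  intro x hx
  obtain ⟨i, h1, h2⟩ := Stage.mem_carrier.mp hx
  exact Stage.mem_carrier.mpr ⟨i.1.1, (R.pos_le_nextPos i).trans h1,
    h2.trans (R.nextPos_add_le i)⟩

lemma two_mul_scale_le : 2 * S.scale ≤ R.next.scale := by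
  have h : 4 ≤ R.ratio := R.four_le_B.trans (Nat.le_mul_of_pos_right _ (pow_pos R.P_pos 4))
  change 2 * S.scale ≤ S.scale * R.ratio
  nlinarith [S.scale_pos]

lemma card_mul_K_le : Fintype.card S.ι * R.K ≤ 4 * R.P := by
  classical
  have h : Finset.univ.image R.q ⊆ Finset.Icc 1 (4 * R.P) := by
    intro q hq
    obtain ⟨x, -, rfl⟩ := Finset.mem_image.mp hq
    exact Finset.mem_Icc.mpr ⟨(R.prime x).pos, R.q_le x⟩
  have := Finset.card_le_card h
  rw [Finset.card_image_of_injective _ R.injective, Nat.card_Icc, Finset.card_univ,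
    Fintype.card_prod, Fintype.card_fin] at this
  omega

/-- A stage has few intervals compared with their length: this makes the limit set at most
`1 / 2`-dimensional. -/
lemma card_next_le : (Fintype.card R.next.ι : ℝ) ≤ 16 * √R.next.scale := by
  have h1 : Fintype.card R.next.ι ≤ 16 * R.P ^ 2 := by
    change Fintype.card (Σ x : S.ι × Fin R.K, Fin (R.q x - 1)) ≤ _
    rw [Fintype.card_sigma]
    calc _ ≤ ∑ x : S.ι × Fin R.K, 4 * R.P := by
          refine Finset.sum_le_sum fun x _ => ?_
          have := R.q_le x
          rw [Fintype.card_fin]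
          omega
      _ = (Fintype.card S.ι * R.K) * (4 * R.P) := by simp
      _ ≤ (4 * R.P) * (4 * R.P) := Nat.mul_le_mul_right _ R.card_mul_K_le
      _ = 16 * R.P ^ 2 := by ring
  have h2 : ((R.P : ℝ) ^ 2) ≤ √R.next.scale := by
    apply Real.le_sqrt_of_sq_le
    have : (R.P ^ 2) ^ 2 ≤ S.scale * (R.B * R.P ^ 4) := by
      have := Nat.mul_le_mul S.scale_pos (Nat.mul_le_mul (show 1 ≤ R.B by
        have := R.four_le_B; omega) (le_refl (R.P ^ 4)))
      calc (R.P ^ 2) ^ 2 = 1 * (1 * R.P ^ 4) := by ring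
        _ ≤ _ := this
    exact_mod_cast this
  calc (Fintype.card R.next.ι : ℝ) ≤ 16 * (R.P : ℝ) ^ 2 := by exact_mod_cast h1
    _ ≤ _ := by gcongr

lemma fourier_next_sub (ξ : ℝ) :
    R.next.fourier ξ - S.fourier ξ
      = ∑ x : S.ι × Fin R.K, ((S.weight x.1 / R.K : ℝ) : ℂ) * echar (S.pos x.1 * ξ) *
        (nonzeroResidueMean (R.q x) (ξ / S.scale) * unitFourier (ξ / S.scale / R.ratio)
          - unitFourier (ξ / S.scale)) := by
  have hK : (R.K : ℂ) ≠ 0 := by exact_mod_cast R.K_pos.ne'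
  have h1 : R.next.fourier ξ = ∑ x : S.ι × Fin R.K,
      ((S.weight x.1 / R.K : ℝ) : ℂ) * echar (S.pos x.1 * ξ) *
        (nonzeroResidueMean (R.q x) (ξ / S.scale) * unitFourier (ξ / S.scale / R.ratio)) := by
    change (∑ i : (Σ x : S.ι × Fin R.K, Fin (R.q x - 1)),
      ((S.weight i.1.1 / (R.K * (R.q i.1 - 1 : ℕ)) : ℝ) : ℂ) * echar (R.nextPos i * ξ))
        * unitFourier (ξ / (S.scale * R.ratio : ℕ)) = _
    rw [Fintype.sum_sigma, Finset.sum_mul]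
    refine Finset.sum_congr rfl fun x _ => ?_
    rw [Nat.cast_mul, ← div_div, ← mul_assoc]
    congr 1
    unfold nonzeroResidueMean
    rw [← Fin.sum_univ_eq_sum_range (fun r => echar (ξ / S.scale * ((r + 1 : ℕ) / (R.q x : ℝ)))),
      ← mul_assoc, Finset.mul_sum]
    refine Finset.sum_congr rfl fun r _ => ?_
    unfold nextPos
    rw [add_mul, echar_add,
      show ((r + 1 : ℕ) / (R.q x : ℝ)) / S.scale * ξ
        = ξ / S.scale * ((r + 1 : ℕ) / (R.q x : ℝ)) by ring]
    push_cast
    rw [← div_div]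
    ring
  have h2 : S.fourier ξ = ∑ x : S.ι × Fin R.K,
      ((S.weight x.1 / R.K : ℝ) : ℂ) * echar (S.pos x.1 * ξ) * unitFourier (ξ / S.scale) := by
    unfold Stage.fourier
    rw [Fintype.sum_prod_type, Finset.sum_mul]
    refine Finset.sum_congr rfl fun i _ => ?_
    dsimp only
    rw [Finset.sum_const, Finset.card_univ, Fintype.card_fin, nsmul_eq_mul]
    push_cast
    field_simp
  rw [h1, h2, ← Finset.sum_sub_distrib]
  refine Finset.sum_congr rfl fun x _ => ?_
  ring

end Refinement

/-! ### Solutions inside a refined stage -/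

/-- Four fractions with prime denominators cannot nearly cancel if one of the primes occurs only
once: after clearing denominators the relation is exact, and it fails modulo that prime. -/
lemma prime_not_isolated {D : ℕ} (hD : 0 < D) {p q₂ q₃ q₄ : ℕ} (hp : p.Prime) (h₂ : q₂.Prime)
    (h₃ : q₃.Prime) (h₄ : q₄.Prime) (n₂ : p ≠ q₂) (n₃ : p ≠ q₃) (n₄ : p ≠ q₄)
    {e₁ e₂ e₃ e₄ k₁ k₂ k₃ k₄ r₁ r₂ r₃ r₄ : ℤ}
    (hpD : ¬ (p : ℤ) ∣ D) (hpe : ¬ (p : ℤ) ∣ e₁) (hpr : ¬ (p : ℤ) ∣ r₁)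
    (hsmall : |(e₁ : ℝ) * (k₁ / D + r₁ / p) + e₂ * (k₂ / D + r₂ / q₂)
      + e₃ * (k₃ / D + r₃ / q₃) + e₄ * (k₄ / D + r₄ / q₄)| * (D * p * q₂ * q₃ * q₄) < 1) :
    False := by
  have hD' : (0 : ℝ) < D := by exact_mod_cast hD
  have hp' : (0 : ℝ) < p := by exact_mod_cast hp.pos
  have h₂' : (0 : ℝ) < q₂ := by exact_mod_cast h₂.pos
  have h₃' : (0 : ℝ) < q₃ := by exact_mod_cast h₃.pos
  have h₄' : (0 : ℝ) < q₄ := by exact_mod_cast h₄.pos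
  have hW : (e₁ * k₁ + e₂ * k₂ + e₃ * k₃ + e₄ * k₄) * p * q₂ * q₃ * q₄
      + D * (e₁ * r₁ * q₂ * q₃ * q₄ + e₂ * r₂ * p * q₃ * q₄ + e₃ * r₃ * p * q₂ * q₄
        + e₄ * r₄ * p * q₂ * q₃) = 0 := by
    rw [← Int.abs_lt_one_iff]
    rw [← abs_of_pos (show (0 : ℝ) < D * p * q₂ * q₃ * q₄ by positivity), ← abs_mul] at hsmall
    have e : ((e₁ : ℝ) * (k₁ / D + r₁ / p) + e₂ * (k₂ / D + r₂ / q₂)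
      + e₃ * (k₃ / D + r₃ / q₃) + e₄ * (k₄ / D + r₄ / q₄)) * (D * p * q₂ * q₃ * q₄)
      = (((e₁ * k₁ + e₂ * k₂ + e₃ * k₃ + e₄ * k₄) * p * q₂ * q₃ * q₄
      + D * (e₁ * r₁ * q₂ * q₃ * q₄ + e₂ * r₂ * p * q₃ * q₄ + e₃ * r₃ * p * q₂ * q₄
        + e₄ * r₄ * p * q₂ * q₃) : ℤ) : ℝ) := by
      push_cast
      field_simp
      ring
    rw [e] at hsmall
    exact_mod_cast hsmall
  have hdvd : (p : ℤ) ∣ D * (e₁ * r₁ * q₂ * q₃ * q₄) := by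
    refine ⟨-((e₁ * k₁ + e₂ * k₂ + e₃ * k₃ + e₄ * k₄) * q₂ * q₃ * q₄
      + D * (e₂ * r₂ * q₃ * q₄ + e₃ * r₃ * q₂ * q₄ + e₄ * r₄ * q₂ * q₃)), ?_⟩
    linear_combination hW
  have hpZ : Prime (p : ℤ) := Nat.prime_iff_prime_int.mp hp
  have hne : ∀ {q : ℕ}, q.Prime → p ≠ q → ¬ (p : ℤ) ∣ q := fun hq hpq hd =>
    hpq ((Nat.prime_dvd_prime_iff_eq hp hq).mp (Int.natCast_dvd_natCast.mp hd))
  rcases hpZ.dvd_or_dvd hdvd with h | h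
  · exact hpD h
  rcases hpZ.dvd_or_dvd h with h | h
  swap
  · exact hne h₄ n₄ h
  rcases hpZ.dvd_or_dvd h with h | h
  swap
  · exact hne h₃ n₃ h
  rcases hpZ.dvd_or_dvd h with h | h
  swap
  · exact hne h₂ n₂ h
  rcases hpZ.dvd_or_dvd h with h | h
  · exact hpe h
  · exact hpr h

lemma numerators_eq_of_small {p q : ℕ} (hp : p.Prime) (hq : q.Prime) (hpq : p ≠ q)
    {a b : ℤ} (ha : ¬ (p : ℤ) ∣ a) {r r' t t' : ℕ} (hr : r < p) (hr' : r' < p)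
    (hsmall : |(a : ℝ) * (r / p - r' / p) + b * (t / q - t' / q)| * (p * q) < 1) : r = r' := by
  have hp' : (0 : ℝ) < p := by exact_mod_cast hp.pos
  have hq' : (0 : ℝ) < q := by exact_mod_cast hq.pos
  have hW : a * (r - r') * q + b * (t - t') * p = 0 := by
    rw [← Int.abs_lt_one_iff]
    rw [← abs_of_pos (show (0 : ℝ) < p * q by positivity), ← abs_mul] at hsmall
    have e : ((a : ℝ) * (r / p - r' / p) + b * (t / q - t' / q)) * (p * q)
        = ((a * (r - r') * q + b * (t - t') * p : ℤ) : ℝ) := by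
      push_cast
      field_simp
    rw [e] at hsmall
    exact_mod_cast hsmall
  have hdvd : (p : ℤ) ∣ a * (r - r') * q := ⟨-(b * (t - t')), by linear_combination hW⟩
  have hpZ : Prime (p : ℤ) := Nat.prime_iff_prime_int.mp hp
  rcases hpZ.dvd_or_dvd hdvd with h | h
  · rcases hpZ.dvd_or_dvd h with h | h
    · exact absurd h ha
    · have := Int.eq_zero_of_abs_lt_dvd h (by rw [abs_lt]; omega)
      omega
  · exact absurd ((Nat.prime_dvd_prime_iff_eq hp hq).mp (Int.natCast_dvd_natCast.mp h)) hpq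

/-- All four points lie within `ρ` of the next one in the list. -/
def IsClose (ρ x₁ x₂ y₁ y₂ : ℝ) : Prop := |x₁ - x₂| ≤ ρ ∧ |x₂ - y₁| ≤ ρ ∧ |y₁ - y₂| ≤ ρ

/-- Points of intervals of length `ℓ` are close when the left endpoints of the intervals are. -/
lemma isClose_of_pos {ℓ C : ℝ} {x₁ x₂ y₁ y₂ s₁ s₂ t₁ t₂ : ℝ}
    (h₁ : s₁ ≤ x₁ ∧ x₁ ≤ s₁ + ℓ) (h₂ : s₂ ≤ x₂ ∧ x₂ ≤ s₂ + ℓ)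
    (h₃ : t₁ ≤ y₁ ∧ y₁ ≤ t₁ + ℓ) (h₄ : t₂ ≤ y₂ ∧ y₂ ≤ t₂ + ℓ)
    (e₁ : |s₁ - s₂| ≤ C * ℓ) (e₂ : |s₂ - t₁| ≤ C * ℓ) (e₃ : |t₁ - t₂| ≤ C * ℓ) :
    IsClose ((C + 1) * ℓ) x₁ x₂ y₁ y₂ := by
  rw [abs_le] at e₁ e₂ e₃
  refine ⟨?_, ?_, ?_⟩ <;> rw [abs_le] <;> constructor <;> nlinarith

lemma abs_sub_le_of_pair {g : ℤ} (hg : g ≠ 0) {σ ℓ u v δ : ℝ}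
    (h : g * (u - v) = δ) (hδ : |δ| ≤ σ * ℓ) : |u - v| ≤ σ * ℓ := by
  have h1 : (1 : ℝ) ≤ |(g : ℝ)| := by exact_mod_cast Int.one_le_abs hg
  rw [← h, abs_mul] at hδ
  nlinarith [abs_nonneg (u - v)]

lemma abs_combination_le {a b c d ℓ : ℝ} (ha : 0 ≤ a) (hb : 0 ≤ b) (hc : 0 ≤ c) (hd : 0 ≤ d)
    (h : a + b = c + d) {θ₁ θ₂ θ₃ θ₄ : ℝ} (h₁ : 0 ≤ θ₁ ∧ θ₁ ≤ ℓ) (h₂ : 0 ≤ θ₂ ∧ θ₂ ≤ ℓ)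
    (h₃ : 0 ≤ θ₃ ∧ θ₃ ≤ ℓ) (h₄ : 0 ≤ θ₄ ∧ θ₄ ≤ ℓ) :
    |c * θ₃ + d * θ₄ - a * θ₁ - b * θ₂| ≤ (a + b) * ℓ := by
  rw [abs_le]
  constructor
  · nlinarith [mul_nonneg hc h₃.1, mul_nonneg hd h₄.1, mul_le_mul_of_nonneg_left h₁.2 ha,
      mul_le_mul_of_nonneg_left h₂.2 hb]
  · nlinarith [mul_nonneg ha h₁.1, mul_nonneg hb h₂.1, mul_le_mul_of_nonneg_left h₃.2 hc,
      mul_le_mul_of_nonneg_left h₄.2 hd]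

namespace Refinement

variable {S : Stage} (R : Refinement S)

lemma not_prime_dvd_of_lt (x : S.ι × Fin R.K) {n : ℕ} (hn : 0 < n) (h : n ≤ R.P) :
    ¬ (R.q x : ℤ) ∣ n := by
  intro hd
  have := Nat.le_of_dvd hn (Int.natCast_dvd_natCast.mp hd)
  have := R.lt_q x
  omega

/-- The rigidity behind the construction: a solution in the refined stage either lives at the
coarse scale of the original stage, or matches equal coefficients up to the fine scale. Indeed a
prime cannot occur as the denominator of just one of the four points, so the four (interval, prime)
labels form two equal pairs. -/
lemma solution_trichotomy {a b c d : ℕ} (ha : 0 < a) (hb : 0 < b) (hc : 0 < c) (hd : 0 < d)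
    (habcd : a + b = c + d) (hP : a + b + S.denom ≤ R.P) (hB : 512 * (a + b) * S.denom ≤ R.B)
    {x₁ x₂ y₁ y₂ : ℝ} (hx₁ : x₁ ∈ R.next.carrier) (hx₂ : x₂ ∈ R.next.carrier)
    (hy₁ : y₁ ∈ R.next.carrier) (hy₂ : y₂ ∈ R.next.carrier) (h : IsSolution a b c d x₁ x₂ y₁ y₂) :
    IsClose ((a + b + 1) * (1 / S.scale)) x₁ x₂ y₁ y₂ ∨
      (a = c ∧ b = d ∧ |x₁ - y₁| ≤ 1 / R.next.scale ∧ |x₂ - y₂| ≤ 1 / R.next.scale) ∨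
      (a = d ∧ b = c ∧ |x₁ - y₂| ≤ 1 / R.next.scale ∧ |x₂ - y₁| ≤ 1 / R.next.scale) := by
  obtain ⟨⟨n₁, r₁⟩, l₁, u₁⟩ := Stage.mem_carrier.mp hx₁
  obtain ⟨⟨n₂, r₂⟩, l₂, u₂⟩ := Stage.mem_carrier.mp hx₂
  obtain ⟨⟨n₃, r₃⟩, l₃, u₃⟩ := Stage.mem_carrier.mp hy₁
  obtain ⟨⟨n₄, r₄⟩, l₄, u₄⟩ := Stage.mem_carrier.mp hy₂
  unfold IsSolution at h
  have hA : (0 : ℝ) ≤ a := Nat.cast_nonneg a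
  have hB' : (0 : ℝ) ≤ b := Nat.cast_nonneg b
  have hC : (0 : ℝ) ≤ c := Nat.cast_nonneg c
  have hD : (0 : ℝ) ≤ d := Nat.cast_nonneg d
  have hsum : (a : ℝ) + b = c + d := by exact_mod_cast habcd
  have hL : (0 : ℝ) < S.scale := by exact_mod_cast S.scale_pos
  have hM : (0 : ℝ) < R.ratio := by exact_mod_cast R.ratio_pos
  have hD0 : (0 : ℝ) < S.denom := by exact_mod_cast S.denom_pos
  have hcoarse : ∀ (n : S.ι × Fin R.K) (r : Fin (R.q n - 1)) (x : ℝ),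
      R.next.pos ⟨n, r⟩ ≤ x → x ≤ R.next.pos ⟨n, r⟩ + 1 / R.next.scale →
      S.pos n.1 ≤ x ∧ x ≤ S.pos n.1 + 1 / S.scale := fun n r x hl hu =>
    ⟨(R.pos_le_nextPos ⟨n, r⟩).trans hl, hu.trans (R.nextPos_add_le ⟨n, r⟩)⟩
  have c₁ := hcoarse n₁ r₁ x₁ l₁ u₁
  have c₂ := hcoarse n₂ r₂ x₂ l₂ u₂
  have c₃ := hcoarse n₃ r₃ y₁ l₃ u₃
  have c₄ := hcoarse n₄ r₄ y₂ l₄ u₄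
  have hcoarseδ := abs_combination_le hA hB' hC hD hsum (ℓ := 1 / (S.scale : ℝ))
    (θ₁ := x₁ - S.pos n₁.1) (θ₂ := x₂ - S.pos n₂.1) (θ₃ := y₁ - S.pos n₃.1)
    (θ₄ := y₂ - S.pos n₄.1) ⟨by linarith [c₁.1], by linarith [c₁.2]⟩
    ⟨by linarith [c₂.1], by linarith [c₂.2]⟩ ⟨by linarith [c₃.1], by linarith [c₃.2]⟩
    ⟨by linarith [c₄.1], by linarith [c₄.2]⟩
  have hfineδ := abs_combination_le hA hB' hC hD hsum (ℓ := 1 / (R.next.scale : ℝ))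
    (θ₁ := x₁ - R.nextPos ⟨n₁, r₁⟩) (θ₂ := x₂ - R.nextPos ⟨n₂, r₂⟩)
    (θ₃ := y₁ - R.nextPos ⟨n₃, r₃⟩) (θ₄ := y₂ - R.nextPos ⟨n₄, r₄⟩)
    ⟨by linarith [show R.nextPos ⟨n₁, r₁⟩ ≤ x₁ from l₁],
      by linarith [show x₁ ≤ R.nextPos ⟨n₁, r₁⟩ + _ from u₁]⟩
    ⟨by linarith [show R.nextPos ⟨n₂, r₂⟩ ≤ x₂ from l₂],
      by linarith [show x₂ ≤ R.nextPos ⟨n₂, r₂⟩ + _ from u₂]⟩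
    ⟨by linarith [show R.nextPos ⟨n₃, r₃⟩ ≤ y₁ from l₃],
      by linarith [show y₁ ≤ R.nextPos ⟨n₃, r₃⟩ + _ from u₃]⟩
    ⟨by linarith [show R.nextPos ⟨n₄, r₄⟩ ≤ y₂ from l₄],
      by linarith [show y₂ ≤ R.nextPos ⟨n₄, r₄⟩ + _ from u₄]⟩
  have hCl : ∀ {s s' : ℝ}, s = s' → |s - s'| ≤ (a + b : ℝ) * (1 / S.scale) := by
    rintro s _ rfl
    rw [sub_self, abs_zero]
    positivity
  have hscale : (R.next.scale : ℝ) = S.scale * R.ratio := by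
    change ((S.scale * R.ratio : ℕ) : ℝ) = _
    push_cast
    rfl
  -- In units of the coarse interval length, the left endpoints nearly solve the equation
  have hmain : |(a : ℝ) * (S.scale * R.nextPos ⟨n₁, r₁⟩) + b * (S.scale * R.nextPos ⟨n₂, r₂⟩)
      - c * (S.scale * R.nextPos ⟨n₃, r₃⟩) - d * (S.scale * R.nextPos ⟨n₄, r₄⟩)|
      ≤ (a + b) / R.ratio := by
    have e : (a : ℝ) * (S.scale * R.nextPos ⟨n₁, r₁⟩) + b * (S.scale * R.nextPos ⟨n₂, r₂⟩)
      - c * (S.scale * R.nextPos ⟨n₃, r₃⟩) - d * (S.scale * R.nextPos ⟨n₄, r₄⟩)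
      = S.scale * (c * (y₁ - R.nextPos ⟨n₃, r₃⟩) + d * (y₂ - R.nextPos ⟨n₄, r₄⟩)
        - a * (x₁ - R.nextPos ⟨n₁, r₁⟩) - b * (x₂ - R.nextPos ⟨n₂, r₂⟩)) := by
      linear_combination S.scale * h
    rw [e, abs_mul, abs_of_pos hL]
    calc _ ≤ S.scale * ((a + b) * (1 / (R.next.scale : ℝ))) := by gcongr
      _ = _ := by rw [hscale]; field_simp
  have hnext : ∀ (n : S.ι × Fin R.K) (r : Fin (R.q n - 1)),
      S.scale * R.nextPos ⟨n, r⟩ = S.scale * S.pos n.1 + ((r : ℕ) + 1 : ℕ) / (R.q n : ℝ) := by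
    intro n r
    unfold nextPos
    field_simp
  simp only [hnext] at hmain
  have hσ : (0 : ℝ) < a + b := by exact_mod_cast (by omega : 0 < a + b)
  have hsize : ∀ m₁ m₂ m₃ m₄ : S.ι × Fin R.K,
      (a + b : ℝ) / R.ratio * (S.denom * R.q m₁ * R.q m₂ * R.q m₃ * R.q m₄) < 1 := by
    intro m₁ m₂ m₃ m₄
    have hP0 : (0 : ℝ) < R.P := by exact_mod_cast R.P_pos
    have hq : ∀ m, (R.q m : ℝ) ≤ 4 * R.P := fun m => by exact_mod_cast R.q_le m
    have hBr : 512 * ((a : ℝ) + b) * S.denom ≤ R.B := by exact_mod_cast hB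
    have hratio : (R.ratio : ℝ) = R.B * (R.P : ℝ) ^ 4 := by unfold ratio; push_cast; rfl
    rw [div_mul_eq_mul_div, div_lt_one hM, hratio]
    calc (a + b : ℝ) * (S.denom * R.q m₁ * R.q m₂ * R.q m₃ * R.q m₄)
        ≤ (a + b : ℝ) * (S.denom * (4 * R.P) * (4 * R.P) * (4 * R.P) * (4 * R.P)) := by
          gcongr <;> exact hq _
      _ = 256 * ((a : ℝ) + b) * S.denom * (R.P : ℝ) ^ 4 := by ring
      _ < 512 * ((a : ℝ) + b) * S.denom * (R.P : ℝ) ^ 4 := by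
          have : 0 < ((a : ℝ) + b) * S.denom * (R.P : ℝ) ^ 4 := by positivity
          linarith
      _ ≤ R.B * (R.P : ℝ) ^ 4 := by gcongr
  have hcop : ∀ (n : S.ι × Fin R.K) (r : Fin (R.q n - 1)), ¬ (R.q n : ℤ) ∣ ((r + 1 : ℕ) : ℤ) := by
    intro n r hdvd
    have h1 := Nat.le_of_dvd (by omega) (Int.natCast_dvd_natCast.mp hdvd)
    have h2 := r.2
    omega
  have hdD : ∀ n, ¬ (R.q n : ℤ) ∣ (S.denom : ℕ) := fun n =>
    R.not_prime_dvd_of_lt n S.denom_pos (by omega)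
  have hda : ∀ n, ¬ (R.q n : ℤ) ∣ (a : ℤ) := fun n => R.not_prime_dvd_of_lt n ha (by omega)
  have hdb : ∀ n, ¬ (R.q n : ℤ) ∣ (b : ℤ) := fun n => R.not_prime_dvd_of_lt n hb (by omega)
  have hdc : ∀ n, ¬ (R.q n : ℤ) ∣ (-c : ℤ) := fun n => by
    rw [dvd_neg]; exact R.not_prime_dvd_of_lt n hc (by omega)
  have hdd : ∀ n, ¬ (R.q n : ℤ) ∣ (-d : ℤ) := fun n => by
    rw [dvd_neg]; exact R.not_prime_dvd_of_lt n hd (by omega)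
  obtain ⟨k₁, hk₁⟩ := S.rational n₁.1
  obtain ⟨k₂, hk₂⟩ := S.rational n₂.1
  obtain ⟨k₃, hk₃⟩ := S.rational n₃.1
  obtain ⟨k₄, hk₄⟩ := S.rational n₄.1
  have hk₁' : (S.scale : ℝ) * S.pos n₁.1 = k₁ / S.denom := by rw [← hk₁]; field_simp
  have hk₂' : (S.scale : ℝ) * S.pos n₂.1 = k₂ / S.denom := by rw [← hk₂]; field_simp
  have hk₃' : (S.scale : ℝ) * S.pos n₃.1 = k₃ / S.denom := by rw [← hk₃]; field_simp
  have hk₄' : (S.scale : ℝ) * S.pos n₄.1 = k₄ / S.denom := by rw [← hk₄]; field_simp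
  have hiso : ∀ {m₁ m₂ m₃ m₄ : S.ι × Fin R.K} {e₁ e₂ e₃ e₄ κ₁ κ₂ κ₃ κ₄ : ℤ}
      {t₁ : Fin (R.q m₁ - 1)} {t₂ : Fin (R.q m₂ - 1)} {t₃ : Fin (R.q m₃ - 1)}
      {t₄ : Fin (R.q m₄ - 1)}, ¬ (R.q m₁ : ℤ) ∣ e₁ →
      |(e₁ : ℝ) * (κ₁ / S.denom + (((t₁ : ℕ) + 1 : ℕ) : ℤ) / R.q m₁)
        + e₂ * (κ₂ / S.denom + (((t₂ : ℕ) + 1 : ℕ) : ℤ) / R.q m₂)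
        + e₃ * (κ₃ / S.denom + (((t₃ : ℕ) + 1 : ℕ) : ℤ) / R.q m₃)
        + e₄ * (κ₄ / S.denom + (((t₄ : ℕ) + 1 : ℕ) : ℤ) / R.q m₄)| ≤ (a + b) / R.ratio →
      R.q m₁ = R.q m₂ ∨ R.q m₁ = R.q m₃ ∨ R.q m₁ = R.q m₄ := by
    intro m₁ m₂ m₃ m₄ e₁ e₂ e₃ e₄ κ₁ κ₂ κ₃ κ₄ t₁ t₂ t₃ t₄ he hsm
    by_contra! hne
    exact prime_not_isolated S.denom_pos (R.prime m₁) (R.prime m₂) (R.prime m₃) (R.prime m₄)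
      hne.1 hne.2.1 hne.2.2 (hdD _) he (hcop m₁ t₁)
      ((mul_le_mul_of_nonneg_right hsm (by positivity)).trans_lt (hsize m₁ m₂ m₃ m₄))
  have i₁ := hiso (m₁ := n₁) (m₂ := n₂) (m₃ := n₃) (m₄ := n₄) (e₁ := a) (e₂ := b) (e₃ := -c)
    (e₄ := -d) (κ₁ := k₁) (κ₂ := k₂) (κ₃ := k₃) (κ₄ := k₄) (t₁ := r₁) (t₂ := r₂) (t₃ := r₃)
    (t₄ := r₄) (hda _) (by
      refine le_of_eq_of_le (congrArg _ ?_) hmain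
      rw [hk₁', hk₂', hk₃', hk₄']; push_cast; ring)
  have i₂ := hiso (m₁ := n₂) (m₂ := n₁) (m₃ := n₃) (m₄ := n₄) (e₁ := b) (e₂ := a) (e₃ := -c)
    (e₄ := -d) (κ₁ := k₂) (κ₂ := k₁) (κ₃ := k₃) (κ₄ := k₄) (t₁ := r₂) (t₂ := r₁) (t₃ := r₃)
    (t₄ := r₄) (hdb _) (by
      refine le_of_eq_of_le (congrArg _ ?_) hmain
      rw [hk₁', hk₂', hk₃', hk₄']; push_cast; ring)
  have i₃ := hiso (m₁ := n₃) (m₂ := n₁) (m₃ := n₂) (m₄ := n₄) (e₁ := -c) (e₂ := a) (e₃ := b)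
    (e₄ := -d) (κ₁ := k₃) (κ₂ := k₁) (κ₃ := k₂) (κ₄ := k₄) (t₁ := r₃) (t₂ := r₁) (t₃ := r₂)
    (t₄ := r₄) (hdc _) (by
      refine le_of_eq_of_le (congrArg _ ?_) hmain
      rw [hk₁', hk₂', hk₃', hk₄']; push_cast; ring)
  have i₄ := hiso (m₁ := n₄) (m₂ := n₁) (m₃ := n₂) (m₄ := n₃) (e₁ := -d) (e₂ := a) (e₃ := b)
    (e₄ := -c) (κ₁ := k₄) (κ₂ := k₁) (κ₃ := k₂) (κ₄ := k₃) (t₁ := r₄) (t₂ := r₁) (t₃ := r₂)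
    (t₄ := r₃) (hdd _) (by
      refine le_of_eq_of_le (congrArg _ ?_) hmain
      rw [hk₁', hk₂', hk₃', hk₄']; push_cast; ring)
  -- No prime is isolated, so the four primes form two equal pairs
  have hpairs : (n₁ = n₂ ∧ n₃ = n₄) ∨ (n₁ = n₃ ∧ n₂ = n₄) ∨ (n₁ = n₄ ∧ n₂ = n₃) := by
    simp only [R.injective.eq_iff] at i₁ i₂ i₃ i₄
    grind
  have hsmall₂ : ∀ {m₁ m₂ : S.ι × Fin R.K} {z : ℝ}, |z| ≤ (a + b) / R.ratio →
      |z| * (R.q m₁ * R.q m₂) < 1 := by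
    intro m₁ m₂ z hz
    refine lt_of_le_of_lt ?_ (hsize m₁ m₂ m₂ m₂)
    have h1 : ∀ m, (1 : ℝ) ≤ R.q m := fun m => by exact_mod_cast (R.prime m).pos
    have h2 : (1 : ℝ) ≤ S.denom := by exact_mod_cast S.denom_pos
    have h3 : (R.q m₁ * R.q m₂ : ℝ) ≤ S.denom * R.q m₁ * R.q m₂ * R.q m₂ * R.q m₂ := by
      calc (R.q m₁ * R.q m₂ : ℝ) = 1 * R.q m₁ * R.q m₂ * 1 * 1 := by ring
        _ ≤ _ := by gcongr <;> first | exact h2 | exact h1 _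
    gcongr
  rcases hpairs with ⟨rfl, rfl⟩ | ⟨rfl, rfl⟩ | ⟨rfl, rfl⟩
  · left
    refine isClose_of_pos c₁ c₂ c₃ c₄ (hCl rfl) ?_ (hCl rfl)
    refine abs_sub_le_of_pair (g := (a + b : ℤ)) (by omega) ?_ hcoarseδ
    push_cast
    linear_combination -S.pos n₃.1 * hsum + h
  · by_cases hac : a = c
    · obtain rfl := hac
      obtain rfl : b = d := by omega
      by_cases hnn : n₁ = n₂
      · obtain rfl := hnn
        exact Or.inl (isClose_of_pos c₁ c₂ c₃ c₄ (hCl rfl) (hCl rfl) (hCl rfl))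
      right; left
      have hz : |(a : ℝ) * (((r₁ : ℕ) + 1 : ℕ) / (R.q n₁ : ℝ) - ((r₃ : ℕ) + 1 : ℕ) / (R.q n₁ : ℝ))
          + b * (((r₂ : ℕ) + 1 : ℕ) / (R.q n₂ : ℝ) - ((r₄ : ℕ) + 1 : ℕ) / (R.q n₂ : ℝ))|
          ≤ (a + b) / R.ratio := by
        refine le_of_eq_of_le (congrArg _ ?_) hmain
        ring
      have hqne : R.q n₁ ≠ R.q n₂ := fun h => hnn (R.injective h)
      have hr₁₃ := numerators_eq_of_small (a := a) (b := b) (r := r₁ + 1) (r' := r₃ + 1)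
        (t := r₂ + 1) (t' := r₄ + 1) (R.prime n₁) (R.prime n₂) hqne (hda _)
        (by have := r₁.2; omega) (by have := r₃.2; omega)
        (by simpa using hsmall₂ (m₁ := n₁) (m₂ := n₂) hz)
      have hr₂₄ := numerators_eq_of_small (a := b) (b := a) (r := r₂ + 1) (r' := r₄ + 1)
        (t := r₁ + 1) (t' := r₃ + 1) (R.prime n₂) (R.prime n₁) hqne.symm
        (hdb _) (by have := r₂.2; omega) (by have := r₄.2; omega)
        (by rw [add_comm] at hz; simpa using hsmall₂ (m₁ := n₂) (m₂ := n₁) hz)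
      obtain rfl : r₁ = r₃ := Fin.ext (by omega)
      obtain rfl : r₂ = r₄ := Fin.ext (by omega)
      refine ⟨rfl, rfl, ?_, ?_⟩ <;> rw [abs_le] <;> constructor <;> linarith
    · left
      have hdist := abs_sub_le_of_pair (g := (a - c : ℤ)) (u := S.pos n₁.1) (v := S.pos n₂.1)
        (by omega) (by push_cast; linear_combination -S.pos n₂.1 * hsum + h) hcoarseδ
      exact isClose_of_pos c₁ c₂ c₃ c₄ hdist (by rwa [abs_sub_comm]) hdist
  · by_cases had : a = d
    · obtain rfl := had
      obtain rfl : b = c := by omega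
      by_cases hnn : n₁ = n₂
      · obtain rfl := hnn
        exact Or.inl (isClose_of_pos c₁ c₂ c₃ c₄ (hCl rfl) (hCl rfl) (hCl rfl))
      right; right
      have hz : |(a : ℝ) * (((r₁ : ℕ) + 1 : ℕ) / (R.q n₁ : ℝ) - ((r₄ : ℕ) + 1 : ℕ) / (R.q n₁ : ℝ))
          + b * (((r₂ : ℕ) + 1 : ℕ) / (R.q n₂ : ℝ) - ((r₃ : ℕ) + 1 : ℕ) / (R.q n₂ : ℝ))|
          ≤ (a + b) / R.ratio := by
        refine le_of_eq_of_le (congrArg _ ?_) hmain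
        ring
      have hqne : R.q n₁ ≠ R.q n₂ := fun h => hnn (R.injective h)
      have hr₁₄ := numerators_eq_of_small (a := a) (b := b) (r := r₁ + 1) (r' := r₄ + 1)
        (t := r₂ + 1) (t' := r₃ + 1) (R.prime n₁) (R.prime n₂) hqne (hda _)
        (by have := r₁.2; omega) (by have := r₄.2; omega)
        (by simpa using hsmall₂ (m₁ := n₁) (m₂ := n₂) hz)
      have hr₂₃ := numerators_eq_of_small (a := b) (b := a) (r := r₂ + 1) (r' := r₃ + 1)
        (t := r₁ + 1) (t' := r₄ + 1) (R.prime n₂) (R.prime n₁) hqne.symm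
        (hdb _) (by have := r₂.2; omega) (by have := r₃.2; omega)
        (by rw [add_comm] at hz; simpa using hsmall₂ (m₁ := n₂) (m₂ := n₁) hz)
      obtain rfl : r₁ = r₄ := Fin.ext (by omega)
      obtain rfl : r₂ = r₃ := Fin.ext (by omega)
      refine ⟨rfl, rfl, ?_, ?_⟩ <;> rw [abs_le] <;> constructor <;> linarith
    · left
      have hdist := abs_sub_le_of_pair (g := (a - d : ℤ)) (u := S.pos n₁.1) (v := S.pos n₂.1)
        (by omega) (by push_cast; linear_combination -S.pos n₂.1 * hsum + h) hcoarseδ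
      exact isClose_of_pos c₁ c₂ c₃ c₄ hdist (hCl rfl) (by rwa [abs_sub_comm])

end Refinement

/-! ### Fourier decay of a refinement -/

namespace Refinement

variable {S : Stage} (R : Refinement S)

lemma norm_fourier_next_sub_le_sum (ξ : ℝ) :
    ‖R.next.fourier ξ - S.fourier ξ‖ ≤ ∑ x : S.ι × Fin R.K, S.weight x.1 / R.K *
      ‖nonzeroResidueMean (R.q x) (ξ / S.scale) * unitFourier (ξ / S.scale / R.ratio)
        - unitFourier (ξ / S.scale)‖ := by
  rw [R.fourier_next_sub]
  refine (norm_sum_le _ _).trans (Finset.sum_le_sum fun x _ => ?_)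
  rw [norm_mul, norm_mul, norm_echar, mul_one, Complex.norm_real, Real.norm_eq_abs,
    abs_of_nonneg (div_nonneg (S.weight_nonneg _) (by positivity))]

lemma norm_fourier_next_sub_le_low (ξ : ℝ) (h : |ξ / S.scale| ≤ (R.P : ℝ) / 2) :
    ‖R.next.fourier ξ - S.fourier ξ‖ ≤ 12 / R.P := by
  have hP : (0 : ℝ) < R.P := by exact_mod_cast R.P_pos
  refine (R.norm_fourier_next_sub_le_sum ξ).trans ?_
  calc _ ≤ ∑ x : S.ι × Fin R.K, S.weight x.1 / R.K * (12 / R.P) := by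
        refine Finset.sum_le_sum fun x _ => ?_
        have hq : (R.P : ℝ) ≤ R.q x := by exact_mod_cast (R.lt_q x).le
        refine mul_le_mul_of_nonneg_left ?_ (div_nonneg (S.weight_nonneg _) (by positivity))
        refine (norm_nonzeroResidueMean_mul_sub_le (R.q x) (R.prime x).two_le R.ratio
          (by exact_mod_cast R.q_le_ratio x) _ (h.trans (by gcongr))).trans ?_
        gcongr
    _ = 12 / R.P := by rw [← Finset.sum_mul, R.sum_weight_div, one_mul]

lemma sum_norm_nonzeroResidueMean_le (t : ℝ) (ht : (R.P : ℝ) / 2 ≤ |t|) (ht1 : 1 ≤ |t|) :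
    ∑ x, ‖nonzeroResidueMean (R.q x) t‖ ≤ 32 * (1 + Real.log (6 * |t|)) ^ 2 := by
  classical
  have hP : (0 : ℝ) < R.P := by exact_mod_cast R.P_pos
  have h1 : ∑ x, ‖residueMean (R.q x) t‖ ≤ 12 * (1 + Real.log (6 * |t|)) ^ 2 := by
    rw [← Finset.sum_image (f := fun q => ‖residueMean q t‖) (g := R.q)
      (fun x _ y _ h => R.injective h)]
    refine sum_norm_residueMean_le R.P R.P_pos _ ?_ t ht ht1
    intro q hq
    obtain ⟨x, -, rfl⟩ := Finset.mem_image.mp hq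
    exact ⟨R.prime x, R.lt_q x, R.q_le x⟩
  have h2 : ∑ x : S.ι × Fin R.K, (2 : ℝ) / R.q x ≤ 8 := by
    calc _ ≤ ∑ x : S.ι × Fin R.K, (2 : ℝ) / R.P := by
          refine Finset.sum_le_sum fun x _ => ?_
          have hq : (R.P : ℝ) ≤ R.q x := by exact_mod_cast (R.lt_q x).le
          gcongr
      _ = ((Fintype.card S.ι * R.K : ℕ) : ℝ) * (2 / R.P) := by
          simp [Finset.sum_const, Finset.card_univ, Fintype.card_prod]
      _ ≤ ((4 * R.P : ℕ) : ℝ) * (2 / R.P) :=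
          mul_le_mul_of_nonneg_right (Nat.cast_le.mpr R.card_mul_K_le) (by positivity)
      _ = 8 := by push_cast; field_simp; norm_num
  have hlog : 0 ≤ Real.log (6 * |t|) := Real.log_nonneg (by linarith)
  calc _ ≤ ∑ x, (2 * ‖residueMean (R.q x) t‖ + 2 / R.q x) :=
        Finset.sum_le_sum fun x _ => norm_nonzeroResidueMean_le _ (R.prime x).two_le t
    _ = 2 * ∑ x, ‖residueMean (R.q x) t‖ + ∑ x : S.ι × Fin R.K, (2 : ℝ) / R.q x := by
        rw [Finset.sum_add_distrib, Finset.mul_sum]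
    _ ≤ 32 * (1 + Real.log (6 * |t|)) ^ 2 := by nlinarith

/-- The transform of a short interval decays beyond the frequency `ratio = B * P ^ 4`, and the
interpolated bound `|t| ^ (-1 / 4)` exactly recovers the factor `P`. -/
lemma norm_unitFourier_div_ratio_le (t : ℝ) (ht : 0 < |t|) :
    ‖unitFourier (t / R.ratio)‖ ≤ R.B * R.P * |t| ^ (-(1 / 4) : ℝ) := by
  have hM : (0 : ℝ) < R.ratio := by exact_mod_cast R.ratio_pos
  have hP : (0 : ℝ) < R.P := by exact_mod_cast R.P_pos
  have hB : (1 : ℝ) ≤ R.B := by exact_mod_cast (by have := R.four_le_B; omega : 1 ≤ R.B)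
  have h1 := norm_unitFourier_le_one (t / R.ratio)
  have h2 := norm_unitFourier_mul_abs_le (t / R.ratio)
  have h0 := norm_nonneg (unitFourier (t / R.ratio))
  rw [abs_div, abs_of_pos hM, ← mul_div_assoc, div_le_one hM] at h2
  set u := ‖unitFourier (t / R.ratio)‖
  have hratio : (R.ratio : ℝ) = R.B * (R.P : ℝ) ^ 4 := by unfold ratio; push_cast; rfl
  rw [Real.rpow_neg ht.le, ← div_eq_mul_inv, le_div_iff₀ (by positivity)]
  have h4 : (u * |t| ^ (1 / 4 : ℝ)) ^ 4 ≤ (R.B * R.P : ℝ) ^ 4 := by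
    have e : (|t| ^ (1 / 4 : ℝ)) ^ 4 = |t| := by
      rw [← Real.rpow_natCast, ← Real.rpow_mul ht.le]
      norm_num
    rw [mul_pow, e, mul_pow]
    calc u ^ 4 * |t| ≤ u * |t| := by
          gcongr
          exact pow_le_of_le_one h0 h1 (by norm_num)
      _ ≤ R.B * (R.P : ℝ) ^ 4 := by rw [← hratio]; exact h2
      _ ≤ (R.B : ℝ) ^ 4 * (R.P : ℝ) ^ 4 := by
          gcongr
          exact le_self_pow₀ hB (by norm_num)
  exact le_of_pow_le_pow_left₀ (by norm_num) (by positivity) h4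

/-- At high frequencies the change of the Fourier transform is `O(|t| ^ (-1 / 4))` up to
logarithms. The hypothesis `hK` says that the refinement uses, up to a logarithm, as many primes as
there can be. -/
lemma norm_fourier_next_sub_le_high (ξ : ℝ) (h : (R.P : ℝ) / 2 ≤ |ξ / S.scale|)
    (h1 : 1 ≤ |ξ / S.scale|)
    (hK : (R.P : ℝ) ≤ R.K * (2 * Fintype.card S.ι * Real.log (4 * R.P))) :
    ‖R.next.fourier ξ - S.fourier ξ‖ ≤ (64 * Fintype.card S.ι * R.B + 1) *
      (1 + Real.log (8 * |ξ / S.scale|)) ^ 3 * |ξ / S.scale| ^ (-(1 / 4) : ℝ) := by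
  set t := ξ / S.scale
  have ht0 : 0 < |t| := by linarith
  have hP : (1 : ℝ) ≤ R.P := by exact_mod_cast R.P_pos
  have hK0 : (0 : ℝ) < R.K := by exact_mod_cast R.K_pos
  have hlog8 : 0 ≤ Real.log (8 * |t|) := Real.log_nonneg (by linarith)
  have hlog6 : 0 ≤ Real.log (6 * |t|) := Real.log_nonneg (by linarith)
  have hlogP : 0 ≤ Real.log (4 * R.P) := Real.log_nonneg (by linarith)
  set ℓ := Real.log (8 * |t|)
  have hu := R.norm_unitFourier_div_ratio_le t ht0
  have hv : ‖unitFourier t‖ ≤ |t| ^ (-(1 / 4) : ℝ) := by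
    have := norm_unitFourier_mul_abs_le t
    rw [← le_div_iff₀ ht0, one_div, ← Real.rpow_neg_one] at this
    exact this.trans (Real.rpow_le_rpow_of_exponent_le h1 (by norm_num))
  have hsum := R.sum_norm_nonzeroResidueMean_le t h h1
  set A := |t| ^ (-(1 / 4) : ℝ)
  have hA : 0 ≤ A := by positivity
  refine (R.norm_fourier_next_sub_le_sum ξ).trans ?_
  have step1 : ∑ x : S.ι × Fin R.K, S.weight x.1 / R.K *
      ‖nonzeroResidueMean (R.q x) t * unitFourier (t / R.ratio) - unitFourier t‖
      ≤ (∑ x, ‖nonzeroResidueMean (R.q x) t‖) * (1 / R.K * (R.B * R.P * A)) + A := by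
    calc _ ≤ ∑ x : S.ι × Fin R.K, (‖nonzeroResidueMean (R.q x) t‖ * (1 / R.K * (R.B * R.P * A))
          + S.weight x.1 / R.K * A) := by
          refine Finset.sum_le_sum fun x _ => ?_
          have hw0 : 0 ≤ S.weight x.1 / R.K := div_nonneg (S.weight_nonneg _) hK0.le
          have hw1 : S.weight x.1 / R.K ≤ 1 / R.K := by
            gcongr
            exact S.weight_le_one _
          calc _ ≤ S.weight x.1 / R.K *
                (‖nonzeroResidueMean (R.q x) t‖ * (R.B * R.P * A) + A) := by
                gcongr
                refine (norm_sub_le _ _).trans ?_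
                rw [norm_mul]
                gcongr
            _ = ‖nonzeroResidueMean (R.q x) t‖ * (S.weight x.1 / R.K * (R.B * R.P * A))
                + S.weight x.1 / R.K * A := by ring
            _ ≤ _ := by gcongr
      _ = _ := by
          rw [Finset.sum_add_distrib, ← Finset.sum_mul, ← Finset.sum_mul, R.sum_weight_div,
            one_mul]
  refine step1.trans ?_
  have hPK : 1 / (R.K : ℝ) * (R.B * R.P * A)
      ≤ R.B * (2 * Fintype.card S.ι * ℓ) * A := by
    have : (R.P : ℝ) / R.K ≤ 2 * Fintype.card S.ι * ℓ := by
      rw [div_le_iff₀ hK0, mul_comm]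
      refine hK.trans ?_
      have : Real.log (4 * R.P) ≤ ℓ := Real.log_le_log (by linarith) (by linarith)
      gcongr
    calc _ = R.B * ((R.P : ℝ) / R.K) * A := by ring
      _ ≤ _ := by gcongr
  have hlog68 : Real.log (6 * |t|) ≤ ℓ := Real.log_le_log (by linarith) (by linarith)
  calc _ ≤ (32 * (1 + ℓ) ^ 2) * (R.B * (2 * Fintype.card S.ι * (1 + ℓ)) * A)
        + (1 + ℓ) ^ 3 * A := by
        refine add_le_add (mul_le_mul (hsum.trans (by gcongr)) (hPK.trans ?_) (by positivity)
          (by positivity)) ?_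
        · gcongr
          linarith
        · exact le_mul_of_one_le_left hA (one_le_pow₀ (by linarith))
    _ = _ := by ring

end Refinement

lemma eventually_const_mul_rpow_le {C ε s : ℝ} (hε : 0 < ε) (hs : s < 0) :
    ∀ᶠ x : ℝ in Filter.atTop, C * x ^ s ≤ ε := by
  have h := (tendsto_rpow_neg_atTop (neg_pos.mpr hs)).const_mul C
  rw [neg_neg, mul_zero] at h
  exact h.eventually_le_const hε

lemma eventually_log_pow_mul_rpow_le {C ε κ : ℝ} (hC : 0 ≤ C) (hε : 0 < ε) (hκ0 : 0 ≤ κ)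
    (hκ : κ < 1 / 4) {L : ℝ} (hL : 1 ≤ L) :
    ∀ᶠ x : ℝ in Filter.atTop, C * (1 + Real.log (8 * x)) ^ 3 * x ^ (-(1 / 4) : ℝ)
      ≤ ε * (1 + L * x) ^ (-κ) := by
  set s : ℝ := (1 / 4 - κ) / 6 with hs
  have hs0 : 0 < s := by rw [hs]; linarith
  have hlog : ∀ᶠ y : ℝ in Filter.atTop, 1 + Real.log y ≤ y ^ s := by
    have h1 : (fun _ : ℝ => (1 : ℝ)) =o[Filter.atTop] fun y : ℝ => y ^ s :=
      Asymptotics.isLittleO_const_left.mpr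
        (Or.inr (tendsto_norm_atTop_atTop.comp (tendsto_rpow_atTop hs0)))
    have h2 := (h1.add (isLittleO_log_rpow_atTop hs0)).bound one_pos
    filter_upwards [h2, Filter.eventually_gt_atTop 0] with y hy hy0
    rw [one_mul, Real.norm_eq_abs, Real.norm_eq_abs, abs_of_pos (Real.rpow_pos_of_pos hy0 s)] at hy
    exact (le_abs_self _).trans hy
  have ht : Filter.Tendsto (fun x : ℝ => 8 * x) Filter.atTop Filter.atTop :=
    Filter.tendsto_id.const_mul_atTop (by norm_num)
  filter_upwards [ht.eventually hlog, Filter.eventually_ge_atTop 1,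
    eventually_const_mul_rpow_le (C := C * (8 ^ s) ^ 3 * (2 * L) ^ κ) hε
      (show -(3 * s) < 0 by linarith)] with x hx hx1 hx2
  have hx0 : 0 < x := by linarith
  have hlog0 : 0 ≤ Real.log (8 * x) := Real.log_nonneg (by linarith)
  have hLx : 0 < 1 + L * x := by positivity
  have hpow : (1 + Real.log (8 * x)) ^ 3 ≤ (8 ^ s) ^ 3 * x ^ (3 * s) := by
    calc _ ≤ ((8 * x) ^ s) ^ 3 := by gcongr
      _ = _ := by
        rw [Real.mul_rpow (by norm_num) hx0.le, mul_pow, ← Real.rpow_natCast (x ^ s),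
          ← Real.rpow_mul hx0.le]
        congr 2
        push_cast
        ring
  have hκpow : (1 + L * x) ^ κ ≤ (2 * L) ^ κ * x ^ κ := by
    rw [← Real.mul_rpow (by linarith) hx0.le]
    exact Real.rpow_le_rpow hLx.le (by nlinarith) hκ0
  rw [Real.rpow_neg hLx.le, ← div_eq_mul_inv, le_div_iff₀ (Real.rpow_pos_of_pos hLx κ)]
  calc _ ≤ C * ((8 ^ s) ^ 3 * x ^ (3 * s)) * x ^ (-(1 / 4) : ℝ) * ((2 * L) ^ κ * x ^ κ) := by
        gcongr
    _ = C * (8 ^ s) ^ 3 * (2 * L) ^ κ * (x ^ (3 * s) * x ^ (-(1 / 4) : ℝ) * x ^ κ) := by ring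
    _ = C * (8 ^ s) ^ 3 * (2 * L) ^ κ * x ^ (-(3 * s)) := by
        rw [← Real.rpow_add hx0, ← Real.rpow_add hx0]
        congr 2
        rw [hs]
        ring
    _ ≤ ε := hx2

lemma eventually_const_div_le {C ε κ : ℝ} (hC : 0 ≤ C) (hε : 0 < ε) (hκ0 : 0 ≤ κ)
    (hκ : κ < 1) {L : ℝ} (hL : 1 ≤ L) :
    ∀ᶠ x : ℝ in Filter.atTop, C / x ≤ ε * (1 + L * x) ^ (-κ) := by
  filter_upwards [Filter.eventually_ge_atTop 1, eventually_const_mul_rpow_le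
    (C := C * (2 * L) ^ κ) hε (show κ - 1 < 0 by linarith)] with x hx1 hx2
  have hx0 : 0 < x := by linarith
  have hLx : 0 < 1 + L * x := by positivity
  rw [Real.rpow_neg hLx.le, ← div_eq_mul_inv, le_div_iff₀ (Real.rpow_pos_of_pos hLx κ)]
  calc C / x * (1 + L * x) ^ κ ≤ C / x * ((2 * L) * x) ^ κ := by
        gcongr
        nlinarith
    _ = C * (2 * L) ^ κ * x ^ (κ - 1) := by
        rw [Real.mul_rpow (by linarith) hx0.le, Real.rpow_sub_one hx0.ne']
        ring
    _ ≤ ε := hx2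

/-- Refinements with arbitrarily large primes exist, and large primes make the change of the
Fourier transform as small as any power `|ξ| ^ (-κ)` with `κ < 1 / 4`. -/
lemma exists_refinement (S : Stage) (P₀ B₀ : ℕ) {ε κ : ℝ} (hε : 0 < ε) (hκ0 : 0 ≤ κ)
    (hκ : κ < 1 / 4) :
    ∃ R : Refinement S, P₀ ≤ R.P ∧ B₀ ≤ R.B ∧
      ∀ ξ : ℝ, ‖R.next.fourier ξ - S.fourier ξ‖ ≤ ε * (1 + |ξ|) ^ (-κ) := by
  classical
  set V := Fintype.card S.ι with hV
  have hV0 : 0 < V := Fintype.card_pos_iff.mpr S.nonempty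
  set B := B₀ + 4 with hB
  have hL : (1 : ℝ) ≤ S.scale := by exact_mod_cast S.scale_pos
  have hL0 : (0 : ℝ) < S.scale := by linarith
  obtain ⟨X, hX⟩ := Filter.eventually_atTop.mp (eventually_log_pow_mul_rpow_le
    (C := 64 * V * B + 1) (by positivity) hε hκ0 hκ hL)
  have hcnt : ∀ᶠ n : ℕ in Filter.atTop, (2 * V : ℝ) ≤ (n : ℝ) / Real.log (4 * n) := by
    have h : ∀ᶠ x : ℝ in Filter.atTop, (2 * V : ℝ) ≤ x / Real.log (4 * x) := by
      have ht : Filter.Tendsto (fun x : ℝ => 4 * x) Filter.atTop Filter.atTop :=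
        Filter.tendsto_id.const_mul_atTop (by norm_num)
      have h1 := ht.eventually (Real.isLittleO_log_id_atTop.bound
        (show (0 : ℝ) < 1 / (8 * V) by positivity))
      filter_upwards [h1, Filter.eventually_gt_atTop 1] with x hx hx1
      have hlog : 0 < Real.log (4 * x) := Real.log_pos (by linarith)
      rw [Real.norm_eq_abs, Real.norm_eq_abs, abs_of_pos hlog, id, abs_of_pos (by linarith)] at hx
      rw [le_div_iff₀ hlog]
      calc 2 * (V : ℝ) * Real.log (4 * x) ≤ 2 * V * (1 / (8 * V) * (4 * x)) := by gcongr
        _ = x := by field_simp; norm_num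
    exact tendsto_natCast_atTop_atTop.eventually h
  obtain ⟨n, hn1, hn2, hn3, hn4, hn5⟩ := (eventually_card_primes_ge.and (hcnt.and
    ((tendsto_natCast_atTop_atTop.eventually (eventually_const_div_le (C := 12) (by norm_num) hε
      hκ0 (by linarith) hL)).and ((Filter.eventually_ge_atTop (P₀ + 2)).and
      (Filter.eventually_ge_atTop ⌈2 * X⌉₊))))).exists
  set A := (Finset.Ioc n (4 * n)).filter Nat.Prime with hA
  have hn0 : (2 : ℝ) ≤ n := by exact_mod_cast (by omega : 2 ≤ n)
  have hlogn : 0 < Real.log (4 * n) := Real.log_pos (by linarith)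
  have hA2 : 2 * V ≤ A.card := by exact_mod_cast hn2.trans hn1
  -- The primes are shared out equally among the `V` intervals.
  set K := A.card / V with hK
  have hKA : A.card ≤ 2 * (V * K) := by
    have h1 : A.card < V * K + V := by
      have := Nat.div_add_mod A.card V
      have := Nat.mod_lt A.card hV0
      rw [hK]
      omega
    omega
  have hK0 : 0 < K := Nat.div_pos (by omega) hV0
  obtain ⟨f⟩ : Nonempty (S.ι × Fin K ↪ A) := by
    apply Function.Embedding.nonempty_of_card_le
    rw [Fintype.card_prod, Fintype.card_fin, Fintype.card_coe, ← hV]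
    exact Nat.mul_div_le _ _
  have hf : ∀ x, n < (f x : ℕ) ∧ (f x : ℕ) ≤ 4 * n ∧ (f x : ℕ).Prime := by
    intro x
    have h := Finset.mem_filter.mp (f x).2
    have h' := Finset.mem_Ioc.mp h.1
    exact ⟨h'.1, h'.2, h.2⟩
  let R : Refinement S :=
    { P := n
      K := K
      B := B
      q := fun x => f x
      P_pos := by omega
      K_pos := hK0
      four_le_B := by omega
      injective := fun x y h => f.injective (Subtype.ext h)
      prime := fun x => (hf x).2.2
      lt_q := fun x => (hf x).1
      q_le := fun x => (hf x).2.1 }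
  refine ⟨R, show P₀ ≤ n by omega, show B₀ ≤ B by omega, fun ξ => ?_⟩
  have hξ : |ξ| = S.scale * |ξ / S.scale| := by
    rw [abs_div, abs_of_pos hL0]
    field_simp
  rcases le_or_gt |ξ / S.scale| ((n : ℝ) / 2) with h | h
  · refine (R.norm_fourier_next_sub_le_low ξ h).trans (hn3.trans ?_)
    refine mul_le_mul_of_nonneg_left ?_ hε.le
    apply Real.rpow_le_rpow_of_nonpos (by positivity) _ (by linarith)
    rw [hξ]
    have : |ξ / S.scale| ≤ n := h.trans (by linarith)
    gcongr
  · have hKn : (n : ℝ) ≤ K * (2 * V * Real.log (4 * n)) := by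
      rw [div_le_iff₀ hlogn] at hn1
      have : (A.card : ℝ) ≤ 2 * (V * K) := by exact_mod_cast hKA
      calc (n : ℝ) ≤ A.card * Real.log (4 * n) := hn1
        _ ≤ 2 * (V * K) * Real.log (4 * n) := by gcongr
        _ = _ := by ring
    refine (R.norm_fourier_next_sub_le_high ξ h.le (by linarith) hKn).trans ?_
    rw [hξ]
    apply hX
    have : 2 * X ≤ n := (Nat.le_ceil _).trans (by exact_mod_cast hn5)
    linarith

/-! ### The limit measure -/

open MeasureTheory Filter Topology

lemma measureFourier_eq (μ : Measure ℝ) (ξ : ℝ) :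
    measureFourier μ ξ = ∫ x, echar (x * ξ) ∂μ := by
  unfold measureFourier echar
  simp only [mul_assoc]

lemma tendsto_unitFourier_zero : Tendsto unitFourier (𝓝 0) (𝓝 1) := by
  rw [tendsto_iff_norm_sub_tendsto_zero]
  refine squeeze_zero (fun _ => norm_nonneg _) norm_unitFourier_sub_one_le ?_
  have : Continuous fun t : ℝ => 2 * π * |t| := by fun_prop
  simpa using this.tendsto 0

namespace Stage

/-- The left endpoints of a stage, with their weights, as a measure. -/
noncomputable def endpointMeasure (S : Stage) : Measure ℝ :=
  ∑ i, ENNReal.ofReal (S.weight i) • Measure.dirac (S.pos i)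

lemma endpointMeasure_apply_of_carrier_subset (S : Stage) {F : Set ℝ} (hF : S.carrier ⊆ F) :
    S.endpointMeasure F = 1 := by
  have h : ∀ i, (ENNReal.ofReal (S.weight i) • Measure.dirac (S.pos i)) F
      = ENNReal.ofReal (S.weight i) := fun i => by
    rw [Measure.smul_apply, Measure.dirac_apply_of_mem (hF (S.pos_mem_carrier i)), smul_eq_mul,
      mul_one]
  rw [endpointMeasure, Measure.finsetSum_apply, Finset.sum_congr rfl fun i _ => h i,
    ← ENNReal.ofReal_sum_of_nonneg fun i _ => S.weight_nonneg i, S.sum_weight,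
    ENNReal.ofReal_one]

instance (S : Stage) : IsProbabilityMeasure S.endpointMeasure :=
  ⟨S.endpointMeasure_apply_of_carrier_subset (Set.subset_univ _)⟩

lemma fourier_eq_integral (S : Stage) (ξ : ℝ) :
    S.fourier ξ = (∫ x, echar (x * ξ) ∂S.endpointMeasure) * unitFourier (ξ / S.scale) := by
  unfold fourier endpointMeasure
  rw [integral_finsetSum_measure fun i _ =>
    (integrable_dirac (by simp)).smul_measure ENNReal.ofReal_ne_top]
  congr 1
  refine Finset.sum_congr rfl fun i _ => ?_
  rw [integral_smul_measure, integral_dirac, ENNReal.toReal_ofReal (S.weight_nonneg i)]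
  rfl

end Stage

/-- The function `x ↦ e^{-2πixξ}` as a bounded continuous function. -/
noncomputable def echarBounded (ξ : ℝ) : BoundedContinuousFunction ℝ ℂ :=
  BoundedContinuousFunction.ofNormedAddCommGroup (fun x => echar (x * ξ))
    (continuous_echar.comp (continuous_id.mul continuous_const)) 1 fun x => by simp

/-- Nested stages of vanishing interval length carry a limit measure, and eventual bounds for
their Fourier transforms pass to the limit. -/
theorem exists_limit_measure (S : ℕ → Stage) (hS : Antitone fun n => (S n).carrier)
    (hscale : Tendsto (fun n => ((S n).scale : ℝ)) atTop atTop) :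
    ∃ μ : Measure ℝ, IsProbabilityMeasure μ ∧ μ (⋂ n, (S n).carrier)ᶜ = 0 ∧
      ∀ ξ B, (∀ᶠ n in atTop, ‖(S n).fourier ξ‖ ≤ B) → ‖measureFourier μ ξ‖ ≤ B := by
  set ν : ℕ → ProbabilityMeasure ℝ := fun n => ⟨(S n).endpointMeasure, inferInstance⟩ with hν
  have htight : IsTightMeasureSet
      {((μ : ProbabilityMeasure ℝ) : Measure ℝ) | μ ∈ Set.range ν} := by
    rw [isTightMeasureSet_iff_exists_isCompact_measure_compl_le]
    intro ε _
    refine ⟨Set.Icc 0 1, isCompact_Icc, ?_⟩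
    rintro _ ⟨_, ⟨n, rfl⟩, rfl⟩
    have h := (S n).endpointMeasure_apply_of_carrier_subset (S n).carrier_subset_Icc
    have h0 : (S n).endpointMeasure (Set.Icc 0 1)ᶜ = 0 :=
      (prob_compl_eq_zero_iff measurableSet_Icc).mpr h
    exact h0.trans_le zero_le
  -- Along an ultrafilter finer than `atTop` the endpoint measures converge, by tightness.
  obtain ⟨μ, -, hμ⟩ := (isCompact_closure_of_isTightMeasureSet htight).ultrafilter_le_nhds
    ((hyperfilter ℕ).map ν) (by
      rw [Ultrafilter.coe_map, le_principal_iff, mem_map]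
      exact Eventually.of_forall fun n => subset_closure ⟨n, rfl⟩)
  have hlim : Tendsto ν (hyperfilter ℕ) (𝓝 μ) := hμ
  have hle : (hyperfilter ℕ : Filter ℕ) ≤ atTop := Nat.hyperfilter_le_atTop
  refine ⟨μ, inferInstance, ?_, fun ξ B hB => ?_⟩
  · rw [Set.compl_iInter, measure_iUnion_null_iff]
    intro n
    rw [prob_compl_eq_zero_iff (S n).isClosed_carrier.measurableSet]
    refine le_antisymm prob_le_one ?_
    have h := ProbabilityMeasure.limsup_measure_closed_le_of_tendsto hlim (S n).isClosed_carrier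
    refine le_trans ?_ h
    have hev : (fun i => (ν i : Measure ℝ) (S n).carrier) =ᶠ[(hyperfilter ℕ : Filter ℕ)]
        fun _ => (1 : ENNReal) := by
      filter_upwards [hle (eventually_ge_atTop n)] with m hm
      exact (S m).endpointMeasure_apply_of_carrier_subset (hS hm)
    rw [limsup_congr hev, limsup_const]
  · have h1 : Tendsto (fun n => ∫ x, echar (x * ξ) ∂(S n).endpointMeasure)
        (hyperfilter ℕ : Filter ℕ) (𝓝 (∫ x, echar (x * ξ) ∂(μ : Measure ℝ))) :=
      (ProbabilityMeasure.tendsto_iff_forall_integral_rclike_tendsto ℂ).mp hlim (echarBounded ξ)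
    have h2 : Tendsto (fun n => unitFourier (ξ / (S n).scale)) (hyperfilter ℕ : Filter ℕ)
        (𝓝 1) :=
      (tendsto_unitFourier_zero.comp (tendsto_const_nhds.div_atTop hscale)).mono_left hle
    have h3 := (h1.mul h2).norm
    rw [mul_one, ← measureFourier_eq] at h3
    refine le_of_tendsto h3 ((hB.filter_mono hle).mono fun n hn => ?_)
    rwa [← Stage.fourier_eq_integral]

/-! ### Fourier decay and coverings -/

lemma integrable_abs_rpow_mul_exp_neg_sq {s : ℝ} (hs : -1 < s) :
    Integrable fun x : ℝ => |x| ^ s * Real.exp (-x ^ 2) := by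
  have hf : IntegrableOn (fun x : ℝ => |x| ^ s * Real.exp (-x ^ 2)) (Set.Ioi 0) := by
    refine (integrableOn_rpow_mul_exp_neg_mul_sq one_pos hs).congr_fun (fun x hx => ?_)
      measurableSet_Ioi
    simp only [abs_of_pos (Set.mem_Ioi.mp hx), neg_mul, one_mul]
  have hf' : IntegrableOn (fun x : ℝ => |x| ^ s * Real.exp (-x ^ 2)) (Set.Iic 0) := by
    let m : MeasurableEmbedding fun x : ℝ => -x := (Homeomorph.neg ℝ).measurableEmbedding
    rw [← Measure.map_neg_eq_self (volume : Measure ℝ), m.integrableOn_map_iff]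
    simp_rw [Function.comp_def, abs_neg, neg_sq, Set.neg_preimage, Set.neg_Iic, neg_zero]
    exact (integrableOn_Ici_iff_integrableOn_Ioi (by simp)).mpr hf
  rw [← integrableOn_univ, ← Set.Iic_union_Ioi (a := (0 : ℝ))]
  exact hf'.union hf

lemma integral_gaussian_mul_echar (u : ℝ) :
    ∫ η : ℝ, (Real.exp (-η ^ 2) : ℂ) * echar (u * η)
      = ((√π * Real.exp (-(π * u) ^ 2) : ℝ) : ℂ) := by
  have h := fourierIntegral_gaussian (b := 1) (by simp) ((-(2 * π * u) : ℝ) : ℂ)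
  have hl : ∀ η : ℝ, (Real.exp (-η ^ 2) : ℂ) * echar (u * η)
      = Complex.exp (Complex.I * ((-(2 * π * u) : ℝ) : ℂ) * η) * Complex.exp (-1 * (η : ℂ) ^ 2) := by
    intro η
    rw [mul_comm]
    congr 1
    · unfold echar
      congr 1
      push_cast
      ring
    · push_cast
      congr 1
      ring
  rw [integral_congr_ae (ae_of_all _ hl), h, div_one, Complex.ofReal_mul, Real.sqrt_eq_rpow,
    Complex.ofReal_cpow Real.pi_pos.le]
  congr 1
  · norm_num
  · push_cast
    congr 1
    ring

lemma continuous_measureFourier (μ : Measure ℝ) [IsProbabilityMeasure μ] :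
    Continuous (measureFourier μ) := by
  have h : measureFourier μ = fun ξ => ∫ x, echar (x * ξ) ∂μ := funext (measureFourier_eq μ)
  rw [h]
  refine continuous_of_dominated (bound := fun _ => 1) (fun ξ => ?_) (fun ξ => ?_)
    (integrable_const _) (ae_of_all _ fun x => ?_)
  · exact (continuous_echar.comp (by fun_prop)).aestronglyMeasurable
  · exact ae_of_all _ fun x => by simp
  · exact continuous_echar.comp (by fun_prop)

lemma norm_measureFourier_le_one (μ : Measure ℝ) [IsProbabilityMeasure μ] (ξ : ℝ) :
    ‖measureFourier μ ξ‖ ≤ 1 := by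
  rw [measureFourier_eq]
  refine (norm_integral_le_of_norm_le_const (ae_of_all _ fun x => (norm_echar _).le)).trans ?_
  simp

lemma star_echar (x : ℝ) : (starRingEnd ℂ) (echar x) = echar (-x) := by
  unfold echar
  rw [← Complex.exp_conj]
  congr 1
  rw [map_mul, map_neg, Complex.conj_ofReal, Complex.conj_I]
  push_cast
  ring

lemma measureFourier_mul_conj (μ : Measure ℝ) [IsProbabilityMeasure μ] (ξ : ℝ) :
    ((‖measureFourier μ ξ‖ ^ 2 : ℝ) : ℂ) = ∫ z, echar ((z.1 - z.2) * ξ) ∂(μ.prod μ) := by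
  rw [Complex.ofReal_pow, ← Complex.mul_conj', measureFourier_eq, ← integral_conj,
    ← integral_prod_mul]
  refine integral_congr_ae (ae_of_all _ fun z => ?_)
  dsimp only
  rw [star_echar, ← echar_add]
  congr 1
  ring

/-- The energy of `μ` with respect to a Gaussian kernel at scale `1 / L`, in terms of the Fourier
transform. -/
lemma integral_gaussian_mul_norm_sq (μ : Measure ℝ) [IsProbabilityMeasure μ] (L : ℝ) :
    ∫ η : ℝ, Real.exp (-η ^ 2) * ‖measureFourier μ (L * η)‖ ^ 2
      = ∫ z, √π * Real.exp (-(π * (L * (z.1 - z.2))) ^ 2) ∂(μ.prod μ) := by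
  apply Complex.ofReal_injective
  rw [← integral_complex_ofReal, ← integral_complex_ofReal]
  have h1 : ∀ η : ℝ, ((Real.exp (-η ^ 2) * ‖measureFourier μ (L * η)‖ ^ 2 : ℝ) : ℂ)
      = ∫ z, (Real.exp (-η ^ 2) : ℂ) * echar (L * (z.1 - z.2) * η) ∂(μ.prod μ) := by
    intro η
    rw [Complex.ofReal_mul, measureFourier_mul_conj, ← integral_const_mul]
    refine integral_congr_ae (ae_of_all _ fun z => ?_)
    dsimp only
    congr 2
    ring
  rw [integral_congr_ae (ae_of_all _ h1), integral_integral_swap]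
  · exact integral_congr_ae (ae_of_all _ fun z => integral_gaussian_mul_echar _)
  · have hg : Integrable (fun η : ℝ => Real.exp (-η ^ 2)) := by
      simpa using integrable_exp_neg_mul_sq (b := 1) one_pos
    refine (hg.comp_fst (μ.prod μ)).mono' ?_ (ae_of_all _ fun p => ?_)
    · refine Continuous.aestronglyMeasurable ?_
      simp only [Function.uncurry_def]
      exact (by fun_prop : Continuous fun p : ℝ × ℝ × ℝ => (Real.exp (-p.1 ^ 2) : ℂ)).mul
        (continuous_echar.comp (by fun_prop))
    · rw [Function.uncurry_def, norm_mul, norm_echar, mul_one, Complex.norm_real,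
        Real.norm_eq_abs, abs_of_pos (Real.exp_pos _)]

/-- If `N` intervals of length `h` carry the probability measure `μ`, two independent random
points are at distance at most `h` with probability at least `1 / (4 * N)`: at least half of the
mass lies in intervals of mass at least `1 / (2 * N)`. -/
lemma one_div_le_measure_near_diagonal (μ : Measure ℝ) [IsProbabilityMeasure μ] {ι : Type*}
    [Fintype ι] [Nonempty ι] (p : ι → ℝ) (h : ℝ)
    (hμ : μ (⋃ i, Set.Icc (p i) (p i + h))ᶜ = 0) :
    1 / (4 * (Fintype.card ι : ℝ)) ≤ (μ.prod μ).real {z | |z.1 - z.2| ≤ h} := by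
  set N := Fintype.card ι with hN
  have hN0 : (0 : ℝ) < N := by exact_mod_cast Fintype.card_pos
  have hD : MeasurableSet {z : ℝ × ℝ | |z.1 - z.2| ≤ h} :=
    measurableSet_le (by fun_prop) measurable_const
  set ε : ENNReal := ENNReal.ofReal (1 / (2 * N)) with hε
  set f : ℝ → ENNReal := fun x => μ (Prod.mk x ⁻¹' {z : ℝ × ℝ | |z.1 - z.2| ≤ h}) with hf
  have hprod : (μ.prod μ) {z : ℝ × ℝ | |z.1 - z.2| ≤ h} = ∫⁻ x, f x ∂μ :=
    Measure.prod_apply hD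
  have hmark : ε * μ {x | ε ≤ f x} ≤ ∫⁻ x, f x ∂μ :=
    mul_meas_ge_le_lintegral (measurable_measure_prodMk_left hD) ε
  have hgood : ENNReal.ofReal (1 / 2) ≤ μ {x | ε ≤ f x} := by
    set J := (Finset.univ : Finset ι).filter fun i => μ (Set.Icc (p i) (p i + h)) ≤ ε with hJ
    have hsub : {x | ε ≤ f x}ᶜ ⊆
        (⋃ i, Set.Icc (p i) (p i + h))ᶜ ∪ ⋃ i ∈ J, Set.Icc (p i) (p i + h) := by
      intro x hx
      by_cases hxc : x ∈ ⋃ i, Set.Icc (p i) (p i + h)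
      · right
        obtain ⟨i, hi⟩ := Set.mem_iUnion.mp hxc
        refine Set.mem_iUnion₂.mpr ⟨i, ?_, hi⟩
        rw [hJ, Finset.mem_filter]
        refine ⟨Finset.mem_univ _, ?_⟩
        by_contra! hlt
        apply hx
        refine hlt.le.trans (measure_mono fun y hy => ?_)
        simp only [Set.mem_preimage, Set.mem_ofPred_eq]
        rw [abs_le]
        constructor <;> linarith [hi.1, hi.2, hy.1, hy.2]
      · exact Or.inl hxc
    have hbad : μ {x | ε ≤ f x}ᶜ ≤ ENNReal.ofReal (1 / 2) := by
      calc _ ≤ μ (⋃ i, Set.Icc (p i) (p i + h))ᶜ + μ (⋃ i ∈ J, Set.Icc (p i) (p i + h)) :=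
            (measure_mono hsub).trans (measure_union_le _ _)
        _ ≤ 0 + ∑ i ∈ J, μ (Set.Icc (p i) (p i + h)) := by
            rw [hμ]
            gcongr
            exact measure_biUnion_finset_le _ _
        _ ≤ 0 + ∑ _i ∈ J, ε := by
            gcongr with i hi
            exact (Finset.mem_filter.mp hi).2
        _ ≤ N * ε := by
            rw [zero_add, Finset.sum_const, nsmul_eq_mul]
            gcongr
            exact (Finset.card_le_univ J).trans_eq hN.symm
        _ = ENNReal.ofReal (1 / 2) := by
            rw [hε, ← ENNReal.ofReal_natCast, ← ENNReal.ofReal_mul hN0.le]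
            congr 1
            field_simp
    have hmeas : MeasurableSet {x | ε ≤ f x} :=
      measurableSet_le measurable_const (measurable_measure_prodMk_left hD)
    have htot := measure_add_measure_compl (μ := μ) hmeas
    rw [measure_univ] at htot
    have hhalf : ENNReal.ofReal (1 / 2) + ENNReal.ofReal (1 / 2) = 1 := by
      rw [← ENNReal.ofReal_add (by norm_num) (by norm_num)]
      norm_num
    by_contra! hlt
    have : μ {x | ε ≤ f x} + μ {x | ε ≤ f x}ᶜ < ENNReal.ofReal (1 / 2) + ENNReal.ofReal (1 / 2) :=
      ENNReal.add_lt_add_of_lt_of_le (measure_ne_top _ _) hlt hbad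
    rw [htot, hhalf] at this
    exact lt_irrefl _ this
  have hfinal : ENNReal.ofReal (1 / (4 * N)) ≤ (μ.prod μ) {z : ℝ × ℝ | |z.1 - z.2| ≤ h} := by
    rw [hprod]
    refine le_trans ?_ hmark
    calc ENNReal.ofReal (1 / (4 * N)) = ε * ENNReal.ofReal (1 / 2) := by
          rw [hε, ← ENNReal.ofReal_mul (by positivity)]
          congr 1
          field_simp
          norm_num
      _ ≤ _ := by gcongr
  exact (ENNReal.ofReal_le_iff_le_toReal (measure_ne_top _ _)).mp hfinal

/-- A measure of Fourier decay `β < 1` forces coverings by intervals of length `1 / L` to have at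
least a constant times `L ^ β` members. -/
lemma exists_rpow_le_card_of_decay (μ : Measure ℝ) [IsProbabilityMeasure μ] {β C : ℝ}
    (hβ0 : 0 ≤ β) (hβ : β < 1) (hC : 0 < C)
    (hdecay : ∀ ξ, ‖measureFourier μ ξ‖ ≤ C * (1 + |ξ|) ^ (-β / 2)) :
    ∃ A : ℝ, ∀ L : ℝ, 0 < L → ∀ (ι : Type) (_ : Fintype ι) (_ : Nonempty ι) (p : ι → ℝ),
      μ (⋃ i, Set.Icc (p i) (p i + 1 / L))ᶜ = 0 → L ^ β ≤ A * Fintype.card ι := by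
  set I : ℝ := ∫ η : ℝ, |η| ^ (-β) * Real.exp (-η ^ 2) with hI
  have hint := integrable_abs_rpow_mul_exp_neg_sq (s := -β) (by linarith)
  have hk0 : 0 < √π * Real.exp (-π ^ 2) := by positivity
  refine ⟨4 * C ^ 2 * I / (√π * Real.exp (-π ^ 2)), fun L hL ι _ _ p hp => ?_⟩
  set N := Fintype.card ι
  have hN0 : (0 : ℝ) < N := by exact_mod_cast Fintype.card_pos
  have hdiag := one_div_le_measure_near_diagonal μ p (1 / L) hp
  have hlower : √π * Real.exp (-π ^ 2) * (1 / (4 * N))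
      ≤ ∫ z, √π * Real.exp (-(π * (L * (z.1 - z.2))) ^ 2) ∂(μ.prod μ) := by
    have hD : MeasurableSet {z : ℝ × ℝ | |z.1 - z.2| ≤ 1 / L} :=
      measurableSet_le (by fun_prop) measurable_const
    calc _ ≤ √π * Real.exp (-π ^ 2) * (μ.prod μ).real {z | |z.1 - z.2| ≤ 1 / L} := by gcongr
      _ = ∫ z, Set.indicator {z : ℝ × ℝ | |z.1 - z.2| ≤ 1 / L}
            (fun _ => √π * Real.exp (-π ^ 2)) z ∂(μ.prod μ) := by
          rw [integral_indicator_const _ hD, smul_eq_mul, mul_comm]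
      _ ≤ _ := by
          refine integral_mono ((integrable_const _).indicator hD) ?_ fun z => ?_
          · refine Integrable.of_bound (C := √π) (Continuous.aestronglyMeasurable (by fun_prop))
              (ae_of_all _ fun z => ?_)
            rw [Real.norm_eq_abs, abs_of_pos (by positivity)]
            refine mul_le_of_le_one_right (by positivity) (Real.exp_le_one_iff.mpr ?_)
            nlinarith [sq_nonneg (π * (L * (z.1 - z.2)))]
          · by_cases hz : z ∈ {z : ℝ × ℝ | |z.1 - z.2| ≤ 1 / L}
            · rw [Set.indicator_of_mem hz]
              have h1 : |L * (z.1 - z.2)| ≤ 1 := by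
                rw [abs_mul, abs_of_pos hL]
                have := mul_le_mul_of_nonneg_left (show |z.1 - z.2| ≤ 1 / L from hz)
                  hL.le
                rwa [mul_one_div_cancel hL.ne'] at this
              have h2 : (L * (z.1 - z.2)) ^ 2 ≤ 1 := (sq_le_one_iff_abs_le_one _).mpr h1
              refine mul_le_mul_of_nonneg_left (Real.exp_le_exp.mpr (neg_le_neg ?_))
                (Real.sqrt_nonneg _)
              rw [mul_pow]
              exact mul_le_of_le_one_right (by positivity) h2
            · rw [Set.indicator_of_notMem hz]
              positivity
  have hupper : ∫ η : ℝ, Real.exp (-η ^ 2) * ‖measureFourier μ (L * η)‖ ^ 2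
      ≤ C ^ 2 * L ^ (-β) * I := by
    rw [hI, ← integral_const_mul]
    refine integral_mono_ae ?_ (hint.const_mul _) ?_
    · have hg : Integrable (fun η : ℝ => Real.exp (-η ^ 2)) := by
        simpa using integrable_exp_neg_mul_sq (b := 1) one_pos
      refine hg.mono' (Continuous.aestronglyMeasurable ?_) (ae_of_all _ fun η => ?_)
      · have := continuous_measureFourier μ
        fun_prop
      · rw [Real.norm_eq_abs, abs_of_nonneg (by positivity)]
        exact mul_le_of_le_one_right (Real.exp_pos _).le
          (pow_le_one₀ (norm_nonneg _) (norm_measureFourier_le_one μ _))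
    · filter_upwards [compl_mem_ae_iff.mpr (measure_singleton (0 : ℝ))] with η hη
      have hη0 : 0 < |η| := abs_pos.mpr hη
      have hpos : 0 < 1 + |L * η| := by positivity
      have h1 : ‖measureFourier μ (L * η)‖ ^ 2 ≤ C ^ 2 * (L ^ (-β) * |η| ^ (-β)) := by
        calc _ ≤ (C * (1 + |L * η|) ^ (-β / 2)) ^ 2 := by
              gcongr
              exact hdecay _
          _ = C ^ 2 * (1 + |L * η|) ^ (-β) := by
              rw [mul_pow, ← Real.rpow_natCast ((1 + |L * η|) ^ (-β / 2)), ← Real.rpow_mul hpos.le]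
              congr 2
              push_cast
              ring
          _ ≤ C ^ 2 * (L * |η|) ^ (-β) := by
              gcongr ?_ * ?_
              apply Real.rpow_le_rpow_of_nonpos (by positivity) _ (by linarith)
              rw [abs_mul, abs_of_pos hL]
              linarith
          _ = _ := by rw [Real.mul_rpow hL.le hη0.le]
      calc _ ≤ Real.exp (-η ^ 2) * (C ^ 2 * (L ^ (-β) * |η| ^ (-β))) := by gcongr
        _ = _ := by ring
  rw [integral_gaussian_mul_norm_sq] at hupper
  have h := hlower.trans hupper
  rw [Real.rpow_neg hL.le] at h
  have hLβ : 0 < L ^ β := Real.rpow_pos_of_pos hL β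
  rw [div_mul_eq_mul_div, le_div_iff₀ hk0]
  have h' := mul_le_mul_of_nonneg_left h (show 0 ≤ L ^ β * (4 * N) by positivity)
  have e1 : L ^ β * (4 * N) * (√π * Real.exp (-π ^ 2) * (1 / (4 * N)))
      = L ^ β * (√π * Real.exp (-π ^ 2)) := by field_simp
  have e2 : L ^ β * (4 * N) * (C ^ 2 * (L ^ β)⁻¹ * I) = 4 * C ^ 2 * I * N := by field_simp
  rwa [e1, e2] at h'

/-- A set covered, for arbitrarily large `L`, by at most `K √L` intervals of length `1 / L`
carries no measure of Fourier decay exponent larger than `1 / 2`. -/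
lemma le_half_of_mem_fourierDecayExponents (S : ℕ → Stage) {E : Set ℝ} {K : ℝ}
    (hE : ∀ n, E ⊆ (S n).carrier)
    (hscale : Tendsto (fun n => ((S n).scale : ℝ)) atTop atTop)
    (hcard : ∀ᶠ n in atTop, (Fintype.card (S n).ι : ℝ) ≤ K * √(S n).scale)
    {β : ℝ} (hβ : β ∈ fourierDecayExponents E) : β ≤ 1 / 2 := by
  obtain ⟨hβ0, -, μ, hμ, hμE, C, hC, hdecay⟩ := hβ
  by_contra! hlt
  -- The energy integral needs an exponent below `1`, while `β = 1` is possible a priori.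
  set γ : ℝ := min β (3 / 4) with hγ
  have hγ1 : 1 / 2 < γ := lt_min hlt (by norm_num)
  have hγ2 : γ ≤ 3 / 4 := min_le_right _ _
  have hγβ : γ ≤ β := min_le_left _ _
  obtain ⟨A, hA⟩ := exists_rpow_le_card_of_decay μ (β := γ) (C := C) (by linarith) (by linarith) hC
    fun ξ => (hdecay ξ).trans (by
      gcongr ?_ * ?_
      exact Real.rpow_le_rpow_of_exponent_le (by linarith [abs_nonneg ξ]) (by linarith))
  have hlarge : ∀ᶠ n in atTop, |A| * K < ((S n).scale : ℝ) ^ (γ - 1 / 2) :=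
    ((tendsto_rpow_atTop (by linarith)).comp hscale).eventually_gt_atTop _
  obtain ⟨n, h1, h2⟩ := (hcard.and hlarge).exists
  have hL : (0 : ℝ) < (S n).scale := by exact_mod_cast (S n).scale_pos
  have h3 := hA (S n).scale hL (S n).ι inferInstance (S n).nonempty (S n).pos
    (measure_mono_null (Set.compl_subset_compl.mpr (hE n)) hμE)
  have hs : 0 < √((S n).scale : ℝ) := Real.sqrt_pos.mpr hL
  have h4 : ((S n).scale : ℝ) ^ γ = (S n).scale ^ (γ - 1 / 2) * √(S n).scale := by
    rw [Real.sqrt_eq_rpow, ← Real.rpow_add hL]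
    congr 1
    ring
  have h5 : ((S n).scale : ℝ) ^ γ ≤ |A| * K * √(S n).scale := by
    calc _ ≤ A * Fintype.card (S n).ι := h3
      _ ≤ |A| * (K * √(S n).scale) := by
          gcongr
          exact le_abs_self A
      _ = _ := by ring
  rw [h4] at h5
  exact absurd (le_of_mul_le_mul_right h5 hs) (not_le.mpr h2)

/-! ### The limit set -/

/-- The decay exponents imposed on the successive refinements; they increase to `1 / 4`. -/
noncomputable def stageExponent (n : ℕ) : ℝ := 1 / 4 - 1 / (n + 5)

lemma stageExponent_nonneg (n : ℕ) : 0 ≤ stageExponent n := by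
  unfold stageExponent
  have : (1 : ℝ) / (n + 5) ≤ 1 / 4 := by
    apply one_div_le_one_div_of_le (by norm_num)
    linarith [(Nat.cast_nonneg n : (0 : ℝ) ≤ n)]
  linarith

lemma stageExponent_lt (n : ℕ) : stageExponent n < 1 / 4 := by
  unfold stageExponent
  have : (0 : ℝ) < 1 / (n + 5) := by positivity
  linarith

lemma eventually_le_stageExponent {κ : ℝ} (hκ : κ < 1 / 4) :
    ∀ᶠ n in atTop, κ ≤ stageExponent n := by
  have h : Tendsto stageExponent atTop (𝓝 (1 / 4 - 0)) := by
    refine tendsto_const_nhds.sub ?_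
    have h5 : Tendsto (fun n : ℕ => (n : ℝ) + 5) atTop atTop :=
      tendsto_natCast_atTop_atTop.atTop_add tendsto_const_nhds
    exact (tendsto_const_nhds (x := (1 : ℝ))).div_atTop h5
  rw [sub_zero] at h
  exact (h.eventually (lt_mem_nhds hκ)).mono fun n hn => hn.le

/-- The stages of the construction for an equation with coefficient sum `A` on each side. The
changes of the Fourier transform are summable, and all primes exceed the coefficients and the
previous denominator. -/
lemma exists_stage_sequence (A : ℕ) :
    ∃ S : ℕ → Stage, ∀ n, ∃ R : Refinement (S n), S (n + 1) = R.next ∧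
      A + (S n).denom ≤ R.P ∧ 512 * A * (S n).denom ≤ R.B ∧
      ∀ ξ, ‖(S (n + 1)).fourier ξ - (S n).fourier ξ‖
        ≤ (1 / 2) ^ n * (1 + |ξ|) ^ (-stageExponent n) := by
  choose R hP hB hR using fun (n : ℕ) (S : Stage) =>
    exists_refinement S (A + S.denom) (512 * A * S.denom) (ε := (1 / 2) ^ n) (by positivity)
      (stageExponent_nonneg n) (stageExponent_lt n)
  let S : ℕ → Stage := fun n => Nat.rec Stage.initial (fun n S => (R n S).next) n
  exact ⟨S, fun n => ⟨R n (S n), rfl, hP n (S n), hB n (S n), hR n (S n)⟩⟩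

/-- Each single stage has Fourier decay of order `1`, since it is a combination of intervals. -/
lemma Stage.exists_fourier_decay (S : Stage) {κ : ℝ} (hκ : κ ≤ 1) :
    ∃ C : ℝ, 0 < C ∧ ∀ ξ, ‖S.fourier ξ‖ ≤ C * (1 + |ξ|) ^ (-κ) := by
  have hL : (0 : ℝ) < S.scale := by exact_mod_cast S.scale_pos
  refine ⟨1 + S.scale, by positivity, fun ξ => ?_⟩
  have h1 : ‖S.fourier ξ‖ ≤ ‖unitFourier (ξ / S.scale)‖ := by
    unfold Stage.fourier
    rw [norm_mul]
    refine mul_le_of_le_one_left (norm_nonneg _) ((norm_sum_le _ _).trans ?_)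
    rw [← S.sum_weight]
    refine Finset.sum_le_sum fun i _ => ?_
    rw [norm_mul, norm_echar, mul_one, Complex.norm_real, Real.norm_eq_abs,
      abs_of_nonneg (S.weight_nonneg i)]
  have h2 : ‖unitFourier (ξ / S.scale)‖ * |ξ| ≤ S.scale := by
    have h := norm_unitFourier_mul_abs_le (ξ / S.scale)
    rwa [abs_div, abs_of_pos hL, ← mul_div_assoc, div_le_one hL] at h
  have hξ : 0 < 1 + |ξ| := by positivity
  calc ‖S.fourier ξ‖ ≤ (1 + S.scale) * (1 + |ξ|) ^ (-1 : ℝ) := by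
        rw [Real.rpow_neg_one, ← div_eq_mul_inv, le_div_iff₀ hξ]
        nlinarith [norm_unitFourier_le_one (ξ / S.scale), mul_le_mul_of_nonneg_right h1 hξ.le]
    _ ≤ _ := by
        gcongr
        linarith [abs_nonneg ξ]

/-- The Fourier transforms of the stages decay uniformly at every rate below `1 / 4`. -/
lemma exists_uniform_fourier_decay (S : ℕ → Stage)
    (hS : ∀ n ξ, ‖(S (n + 1)).fourier ξ - (S n).fourier ξ‖
      ≤ (1 / 2) ^ n * (1 + |ξ|) ^ (-stageExponent n)) {κ : ℝ} (hκ : κ < 1 / 4) :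
    ∃ C : ℝ, 0 < C ∧ ∀ ξ, ∀ᶠ n in atTop, ‖(S n).fourier ξ‖ ≤ C * (1 + |ξ|) ^ (-κ) := by
  obtain ⟨n₀, hn₀⟩ := eventually_atTop.mp (eventually_le_stageExponent hκ)
  obtain ⟨C, hC, hdecay⟩ := (S n₀).exists_fourier_decay (show κ ≤ 1 by linarith)
  refine ⟨C + 2, by positivity, fun ξ => eventually_atTop.mpr ⟨n₀, fun n hn => ?_⟩⟩
  -- The remainder `2 * (1 / 2) ^ n` of the geometric series makes the induction close.
  have key : ∀ n, n₀ ≤ n →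
      ‖(S n).fourier ξ‖ ≤ (C + 2 - 2 * (1 / 2) ^ n) * (1 + |ξ|) ^ (-κ) := by
    intro n hn
    induction n, hn using Nat.le_induction with
    | base =>
      refine (hdecay ξ).trans ?_
      gcongr
      have : (1 / 2 : ℝ) ^ n₀ ≤ 1 := pow_le_one₀ (by norm_num) (by norm_num)
      linarith
    | succ n hn ih =>
      have hstep : ‖(S (n + 1)).fourier ξ - (S n).fourier ξ‖ ≤ (1 / 2) ^ n * (1 + |ξ|) ^ (-κ) := by
        refine (hS n ξ).trans ?_
        gcongr
        · linarith [abs_nonneg ξ]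
        · exact hn₀ n hn
      have htri := norm_le_norm_add_norm_sub' ((S (n + 1)).fourier ξ) ((S n).fourier ξ)
      rw [pow_succ]
      linarith
  refine (key n hn).trans ?_
  gcongr
  have : (0 : ℝ) < (1 / 2) ^ n := by positivity
  linarith

lemma eq_of_frequently_abs_sub_le {x y : ℝ} {u : ℕ → ℝ} (hu : Tendsto u atTop (𝓝 0))
    (h : ∃ᶠ n in atTop, |x - y| ≤ u n) : x = y := by
  have h0 : |x - y| ≤ 0 := ge_of_tendsto_of_frequently hu h
  exact sub_eq_zero.mp (abs_nonpos_iff.mp h0)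

/-! ### Genus -/

lemma not_isGenusOne_of_eq {a b c d : ℕ} (h : a = c ∨ a = d) : ¬ IsGenusOne a b c d := by
  intro hg
  rcases h with rfl | rfl
  · exact hg {0, 2} (by simp) (by decide) (by simp [eqCoeff])
  · exact hg {0, 3} (by simp) (by decide) (by simp [eqCoeff])

lemma eq_of_not_isGenusOne {a b c d : ℕ} (ha : 0 < a) (hb : 0 < b) (hc : 0 < c) (hd : 0 < d)
    (habcd : a + b = c + d) (h : ¬ IsGenusOne a b c d) : (a = c ∧ b = d) ∨ (a = d ∧ b = c) := by
  unfold IsGenusOne at h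
  push Not at h
  obtain ⟨T, hT, hT', hsum⟩ := h
  have hnot : ∃ i, i ∉ T := by
    by_contra! hall
    exact hT' (Finset.eq_univ_iff_forall.mpr hall)
  have hsum' : ∑ i, (if i ∈ T then eqCoeff a b c d i else 0) = 0 := by
    rw [Finset.sum_ite_mem, Finset.univ_inter, hsum]
  rw [Fin.sum_univ_four] at hsum'
  have hne : 0 ∈ T ∨ 1 ∈ T ∨ 2 ∈ T ∨ 3 ∈ T := by
    obtain ⟨i, hi⟩ := hT
    fin_cases i <;> simp_all
  have hne' : 0 ∉ T ∨ 1 ∉ T ∨ 2 ∉ T ∨ 3 ∉ T := by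
    obtain ⟨i, hi⟩ := hnot
    fin_cases i <;> simp_all
  simp only [eqCoeff, Matrix.cons_val_zero, Matrix.cons_val_one, Matrix.cons_val] at hsum'
  -- Of the fourteen subfamilies, only those of one coefficient from each side can sum to zero.
  split_ifs at hsum' <;> first | omega | simp_all

/-! ### Sets without nontrivial solutions -/

theorem theorem2 (a b c d : ℕ) (ha : 0 < a) (hb : 0 < b) (hc : 0 < c) (hd : 0 < d)
    (habcd : a + b = c + d) :
    ∃ E : Set ℝ, E ⊆ Set.Icc (0 : ℝ) 1 ∧ MeasurableSet E ∧ fourierDimension E = 1 / 2 ∧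
      ¬ ∃ x₁ ∈ E, ∃ x₂ ∈ E, ∃ y₁ ∈ E, ∃ y₂ ∈ E, IsNontrivialSolution a b c d x₁ x₂ y₁ y₂ := by
  obtain ⟨S, hS⟩ := exists_stage_sequence (a + b)
  choose R hR hP hB hdecay using hS
  have hsub : ∀ n, (S (n + 1)).carrier ⊆ (S n).carrier := fun n => by
    rw [hR]
    exact (R n).carrier_next_subset
  have hscale : Tendsto (fun n => ((S n).scale : ℝ)) atTop atTop := by
    have h2 : ∀ n, 2 ^ n ≤ (S n).scale := by
      intro n
      induction n with
      | zero => exact (S 0).scale_pos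
      | succ n ih =>
        have := (R n).two_mul_scale_le
        rw [← hR] at this
        omega
    refine tendsto_atTop_mono (fun n => ?_) (tendsto_pow_atTop_atTop_of_one_lt one_lt_two)
    exact_mod_cast h2 n
  set E : Set ℝ := ⋂ n, (S n).carrier with hE
  have hmem : ∀ {x}, x ∈ E → ∀ n, x ∈ (S n).carrier := fun hx n => Set.mem_iInter.mp hx n
  have hupper : ∀ β ∈ fourierDecayExponents E, β ≤ 1 / 2 := by
    intro β hβ
    refine le_half_of_mem_fourierDecayExponents S (K := 16) (fun n x hx => hmem hx n) hscale ?_ hβ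
    refine eventually_atTop.mpr ⟨1, fun n hn => ?_⟩
    obtain ⟨m, rfl⟩ := Nat.exists_eq_add_of_le' hn
    rw [hR]
    exact (R m).card_next_le
  have hlower : ∀ β, 0 ≤ β → β < 1 / 2 → β ∈ fourierDecayExponents E := by
    intro β hβ0 hβ
    obtain ⟨μ, hμ, hμE, hlim⟩ := exists_limit_measure S (antitone_nat_of_succ_le hsub) hscale
    obtain ⟨C, hC, hCdecay⟩ := exists_uniform_fourier_decay S hdecay (κ := β / 2) (by linarith)
    refine ⟨hβ0, by linarith, μ, hμ, hμE, C, hC, fun ξ => hlim ξ _ ?_⟩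
    rw [neg_div]
    exact hCdecay ξ
  refine ⟨E, (Set.iInter_subset _ 0).trans (S 0).carrier_subset_Icc,
    MeasurableSet.iInter fun n => (S n).isClosed_carrier.measurableSet, ?_, ?_⟩
  · apply le_antisymm
    · exact csSup_le ⟨0, hlower 0 le_rfl (by norm_num)⟩ hupper
    · refine le_of_forall_lt fun t ht => ?_
      have hmax : max 0 ((t + 1 / 2) / 2) < 1 / 2 := max_lt (by norm_num) (by linarith)
      refine lt_of_lt_of_le ?_ (le_csSup ⟨1 / 2, hupper⟩ (hlower _ (le_max_left _ _) hmax))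
      exact lt_max_of_lt_right (by linarith)
  · rintro ⟨x₁, hx₁, x₂, hx₂, y₁, hy₁, y₂, hy₂, hsol, hnt⟩
    refine hnt ⟨hsol, ?_⟩
    have htri := fun n => (R n).solution_trichotomy ha hb hc hd habcd (hP n) (hB n)
      (hR n ▸ hmem hx₁ (n + 1)) (hR n ▸ hmem hx₂ (n + 1)) (hR n ▸ hmem hy₁ (n + 1))
      (hR n ▸ hmem hy₂ (n + 1)) hsol
    simp only [← hR] at htri
    have hinv : Tendsto (fun n => 1 / ((S n).scale : ℝ)) atTop (𝓝 0) :=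
      tendsto_const_nhds.div_atTop hscale
    have hinv' : Tendsto (fun n => 1 / ((S (n + 1)).scale : ℝ)) atTop (𝓝 0) :=
      hinv.comp (tendsto_add_atTop_nat 1)
    have hinvC : Tendsto (fun n => ((a : ℝ) + b + 1) * (1 / ((S n).scale : ℝ))) atTop (𝓝 0) := by
      simpa using hinv.const_mul ((a : ℝ) + b + 1)
    -- One of the three alternatives occurs at infinitely many stages.
    have hfreq := (Eventually.of_forall htri).frequently (f := atTop)
    rw [frequently_or_distrib, frequently_or_distrib] at hfreq
    rcases hfreq with hclose | hmatch | hmatch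
    · have e₁ : x₁ = x₂ := eq_of_frequently_abs_sub_le hinvC (hclose.mono fun n h => h.1)
      have e₂ : x₂ = y₁ := eq_of_frequently_abs_sub_le hinvC (hclose.mono fun n h => h.2.1)
      have e₃ : y₁ = y₂ := eq_of_frequently_abs_sub_le hinvC (hclose.mono fun n h => h.2.2)
      by_cases hg : IsGenusOne a b c d
      · exact Or.inl ⟨hg, e₁, e₂, e₃⟩
      · refine Or.inr ⟨hg, ?_⟩
        rcases eq_of_not_isGenusOne ha hb hc hd habcd hg with ⟨h1, h2⟩ | ⟨h1, h2⟩
        · exact Or.inl ⟨h1, h2, e₁.trans e₂, e₂.trans e₃⟩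
        · exact Or.inr ⟨h1, h2, e₁.trans (e₂.trans e₃), e₂⟩
    · obtain ⟨_, hac, hbd, -⟩ := hmatch.exists
      exact Or.inr ⟨not_isGenusOne_of_eq (Or.inl hac), Or.inl ⟨hac, hbd,
        eq_of_frequently_abs_sub_le hinv' (hmatch.mono fun n h => h.2.2.1),
        eq_of_frequently_abs_sub_le hinv' (hmatch.mono fun n h => h.2.2.2)⟩⟩
    · obtain ⟨_, had, hbc, -⟩ := hmatch.exists
      exact Or.inr ⟨not_isGenusOne_of_eq (Or.inr had), Or.inr ⟨had, hbc,
        eq_of_frequently_abs_sub_le hinv' (hmatch.mono fun n h => h.2.2.1),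
        eq_of_frequently_abs_sub_le hinv' (hmatch.mono fun n h => h.2.2.2)⟩⟩
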